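/- Let $\theta\in\mathbb R\setminus\mathbb Q$, let $\mathbb T=\mathbb R/\mathbb Z$ and let $Tx=x+\theta \bmod 1$ on $\mathbb T$. Let $f:\mathbb T\to\mathbb R$ be a function of bounded variation (BV) with $\int_{\mathbb T}f(x)\,dx=0$. For $x\in\mathbb T$ and $k\ge 0$ put $\rho_k(x)=\exp\big(\sum_{0\le j<k}f(T^jx)\big)$, and for $g:\mathbb T\to\mathbb R$ and $n\ge0$ put $$A(n,g,x)=\frac{\sum_{k=0}^n g(T^kx)/\rho_k(x)}{\sum_{k=0}^n 1/\rho_k(x)}.$$ The space of Borel probability measures on $\mathbb T$ carries the weak-$*$ topology (test functions: continuous functions on $\mathbb T$), and $T\mu$ denotes the image of $\mu$ by $T$. (i) Let $(x_n)_{n\ge1}$ be any sequence in $\mathbb T$ and $(N_n)_{n\ge1}$ a strictly increasing sequence of non-negative integers. Then every weak-$*$ cluster point $\mu$ of the sequence of probability measures $$\left(\frac{\sum_{k=0}^{N_n}\delta_{T^kx_n}/\rho_k(x_n)}{\sum_{k=0}^{N_n}1/\rho_k(x_n)}\right)_{n\ge1}$$ is non-atomic and satisfies $dT\mu=e^{f\circ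 T^{-1}}\,d\mu$. Moreover, there is exactly one Borel probability measure on $\mathbb T$ satisfying this last equation; it is denoted by $\nu_f$, and it is non-atomic. (ii) For every BV function $g:\mathbb T\to\mathbb R$, $A(n,g,x)\to\int_{\mathbb T}g\,d\nu_f$ as $n\to+\infty$, uniformly in $x\in\mathbb T$. -/

import Mathlib

open MeasureTheory Filter Topology

noncomputable section

namespace QuasiPeriodic

/-- The rotation `T x = x + θ mod 1` of the torus `ℝ / ℤ`. -/
def rot (θ : ℝ) (x : UnitAddCircle) : UnitAddCircle := x + (θ : UnitAddCircle)

/-- The inverse rotation `T⁻¹ x = x - θ mod 1`. -/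
def rotInv (θ : ℝ) (x : UnitAddCircle) : UnitAddCircle := x - (θ : UnitAddCircle)

/-- A function on the torus has bounded variation: its lift has bounded variation over one full
turn, both endpoints of the fundamental interval (the same point of the torus) included. -/
def IsBV (f : UnitAddCircle → ℝ) : Prop :=
  BoundedVariationOn (fun t : ℝ => f (t : UnitAddCircle)) (Set.Icc 0 1)

/-- `ρ_n(x) = exp (f_n(x))`, where `f_n(x) = f(x) + f(T x) + ⋯ + f(T^(n-1) x)`. -/
def rho (θ : ℝ) (f : UnitAddCircle → ℝ) (n : ℕ) (x : UnitAddCircle) : ℝ :=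
  Real.exp (birkhoffSum (rot θ) f n x)

/-- The normalization `∑_{k=0}^{n} 1 / ρ_k(x)`. -/
def wsum (θ : ℝ) (f : UnitAddCircle → ℝ) (n : ℕ) (x : UnitAddCircle) : ℝ :=
  ∑ k ∈ Finset.range (n + 1), 1 / rho θ f k x

/-- The weighted average
`A(n, g, x) = (∑_{k=0}^{n} g(T^k x) / ρ_k(x)) / (∑_{k=0}^{n} 1 / ρ_k(x))`. -/
def weightedAvg (θ : ℝ) (f : UnitAddCircle → ℝ) (n : ℕ) (g : UnitAddCircle → ℝ)
    (x : UnitAddCircle) : ℝ :=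
  (∑ k ∈ Finset.range (n + 1), g ((rot θ)^[k] x) / rho θ f k x) / wsum θ f n x

/-- The measure `(∑_{k=0}^{n} δ_{T^k x} / ρ_k(x)) / (∑_{k=0}^{n} 1 / ρ_k(x))` on the torus. -/
def orbitMeasure (θ : ℝ) (f : UnitAddCircle → ℝ) (n : ℕ) (x : UnitAddCircle) :
    Measure UnitAddCircle :=
  ENNReal.ofReal (1 / wsum θ f n x) •
    ∑ k ∈ Finset.range (n + 1),
      ENNReal.ofReal (1 / rho θ f k x) • Measure.dirac ((rot θ)^[k] x)

theorem wsum_pos (θ : ℝ) (f : UnitAddCircle → ℝ) (n : ℕ) (x : UnitAddCircle) :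
    0 < wsum θ f n x :=
  Finset.sum_pos (fun _ _ => one_div_pos.mpr (Real.exp_pos _)) ⟨0, by simp⟩

theorem isProbabilityMeasure_orbitMeasure (θ : ℝ) (f : UnitAddCircle → ℝ) (n : ℕ)
    (x : UnitAddCircle) : IsProbabilityMeasure (orbitMeasure θ f n x) := by
  constructor
  have h : ∑ k ∈ Finset.range (n + 1), ENNReal.ofReal (1 / rho θ f k x)
      = ENNReal.ofReal (wsum θ f n x) :=
    (ENNReal.ofReal_sum_of_nonneg
      (fun _ _ => (one_div_pos.mpr (Real.exp_pos _)).le)).symm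
  have hp := wsum_pos θ f n x
  simp only [orbitMeasure, Measure.smul_apply, Measure.finsetSum_apply, measure_univ,
    smul_eq_mul, mul_one, h]
  rw [← ENNReal.ofReal_mul (one_div_pos.mpr hp).le, one_div_mul_cancel hp.ne',
    ENNReal.ofReal_one]

/-- `orbitMeasure` as a point of the space of Borel probability measures on the torus, which
carries the weak-* topology. -/
def orbitProb (θ : ℝ) (f : UnitAddCircle → ℝ) (n : ℕ) (x : UnitAddCircle) :
    ProbabilityMeasure UnitAddCircle :=
  ⟨orbitMeasure θ f n x, isProbabilityMeasure_orbitMeasure θ f n x⟩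

/-- The equation `dTμ = e^{T⁻¹ f} dμ`, where `Tμ` is the image of `μ` by `T` and
`T⁻¹ f = f ∘ T⁻¹`. -/
def IsQuasiInvariant (θ : ℝ) (f : UnitAddCircle → ℝ) (μ : ProbabilityMeasure UnitAddCircle) :
    Prop :=
  (μ : Measure UnitAddCircle).map (rot θ) =
    (μ : Measure UnitAddCircle).withDensity
      (fun x => ENNReal.ofReal (Real.exp (f (rotInv θ x))))

end QuasiPeriodic

end

namespace QuasiPeriodic

/-! Everything rests on the Denjoy–Koksma inequality: if |θ − p/q| ≤ 1/q² with p and q coprime, the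
q-th Birkhoff sum of f is at most 5V in absolute value, V being the variation bound of f. So the
weights 1/ρ_k and 1/ρ_{k+q} agree up to the factor e^{5V}.

Limits have no atoms and solve the equation. Take J such denominators and a ball so small that no
difference of two of them returns within its diameter. Shifting the visits to the ball by these
denominators then produces distinct times of comparable weight, so the ball has mass at most about
2e^{5V}/J, uniformly in its centre and in the starting point
(`IsVariationBound.exists_radius_orbitMeasure_le`). Hence weak limits are non-atomic and the weight
of each single time vanishes. Tested on an orbit measure, the equation telescopes to two such
weights; it passes to the limit because the countably many discontinuities of f become null.

Uniqueness. An arc of length 3/q and its first q rotates cover the circle with multiplicity at most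
six, and ρ_j varies on the arc by a factor at most e^{5V} for j ≤ q. Thus two solutions are
comparable with a constant C depending only on V (`IsVariationBound.measure_mul_le`). If μ ≥ tν, the
residual μ − tν is again a solution, so it dominates (1 − t)ν/C; iterating gives μ ≥ ν, hence
equality. No ergodicity argument is needed.

Uniform convergence follows by compactness: any limit along a sequence of bad points would have to
be the unique solution. -/

/-! ### Bounded variation on the circle. -/

/-- `W` dominates the increments of the lift of `f`, and grows by `V` over one turn. -/
structure IsVariationBound (f : UnitAddCircle → ℝ) (W : ℝ → ℝ) (V : ℝ) : Prop where
  add_one : ∀ t, W (t + 1) = W t + V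
  abs_sub_le : ∀ s t : ℝ, s ≤ t → |f t - f s| ≤ W t - W s

theorem coe_add_intCast (t : ℝ) (m : ℤ) : ((t + m : ℝ) : UnitAddCircle) = t := by
  have hm : ((m : ℝ) : UnitAddCircle) = 0 := (AddCircle.coe_eq_zero_iff (1 : ℝ)).mpr ⟨m, by simp⟩
  rw [AddCircle.coe_add, hm, add_zero]

theorem coe_fract (t : ℝ) : ((Int.fract t : ℝ) : UnitAddCircle) = t := by
  have := coe_add_intCast (Int.fract t) ⌊t⌋
  rw [Int.fract_add_floor] at this
  exact this.symm

/-- Extend the variation function w of [0, 1] to the line, adding w(1) at each turn. For points in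
different turns, pass through an integer, where the lift takes the common value of both ends of [0,
1]. -/
theorem IsBV.exists_isVariationBound {f : UnitAddCircle → ℝ} (hf : IsBV f) :
    ∃ W V, IsVariationBound f W V := by
  set F : ℝ → ℝ := fun t => f t with hF
  have hl : LocallyBoundedVariationOn F (Set.Icc 0 1) := hf.locallyBoundedVariationOn
  set w : ℝ → ℝ := variationOnFromTo F (Set.Icc 0 1) 0 with hw
  have h0 : (0 : ℝ) ∈ Set.Icc (0 : ℝ) 1 := by simp
  have h1 : (1 : ℝ) ∈ Set.Icc (0 : ℝ) 1 := by simp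
  have w0 : w 0 = 0 := variationOnFromTo.self ..
  have key : ∀ s t, s ∈ Set.Icc (0 : ℝ) 1 → t ∈ Set.Icc (0 : ℝ) 1 → s ≤ t →
      |F t - F s| ≤ w t - w s := by
    intro s t hs ht hst
    have h2 := variationOnFromTo.add hl h0 hs ht
    have h3 : variationOnFromTo F (Set.Icc 0 1) s t
        = (eVariationOn F (Set.Icc 0 1 ∩ Set.Icc s t)).toReal :=
      variationOnFromTo.eq_of_le _ _ hst
    have h4 : |F t - F s| ≤ (eVariationOn F (Set.Icc 0 1 ∩ Set.Icc s t)).toReal :=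
      (hf.mono Set.inter_subset_left).dist_le ⟨ht, hst, le_rfl⟩ ⟨hs, le_rfl, hst⟩
    linarith
  have fr : ∀ t : ℝ, Int.fract t ∈ Set.Icc (0 : ℝ) 1 :=
    fun t => ⟨Int.fract_nonneg t, (Int.fract_lt_one t).le⟩
  have hFf : ∀ t, F t = F (Int.fract t) := fun t => by simp only [hF, coe_fract]
  have hF1 : F 1 = F 0 := by
    have := coe_add_intCast 0 1
    simp only [Int.cast_one, zero_add] at this
    simp only [hF, this]
  have hV : 0 ≤ w 1 := by
    have := key 0 1 h0 h1 zero_le_one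
    rw [w0] at this
    linarith [abs_nonneg (F 1 - F 0)]
  refine ⟨fun t => w 1 * ⌊t⌋ + w (Int.fract t), w 1, fun t => ?_, fun s t hst => ?_⟩
  · simp only [Int.floor_add_one, Int.fract_add_one]
    push_cast; ring
  · change |F t - F s| ≤ _
    rw [hFf t, hFf s]
    rcases (Int.floor_mono hst).eq_or_lt with h | h
    · have h5 : Int.fract s ≤ Int.fract t := by
        rw [Int.fract, Int.fract, h]; linarith
      have := key _ _ (fr s) (fr t) h5
      simp only [h]; linarith
    · have h6 := key 0 _ h0 (fr t) (fr t).1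
      have h7 := key _ 1 (fr s) h1 (fr s).2
      have h8 : ((⌊s⌋ : ℝ)) + 1 ≤ ⌊t⌋ := by exact_mod_cast h
      have h9 : |F (Int.fract t) - F (Int.fract s)|
          ≤ |F (Int.fract t) - F 0| + |F 1 - F (Int.fract s)| := by
        rw [hF1]; exact abs_sub_le _ _ _
      have := mul_le_mul_of_nonneg_left h8 hV
      linarith

namespace IsVariationBound

variable {f : UnitAddCircle → ℝ} {W : ℝ → ℝ} {V : ℝ}

theorem monotone (h : IsVariationBound f W V) : Monotone W := fun s t hst => by
  linarith [h.abs_sub_le s t hst, abs_nonneg (f t - f s)]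

theorem nonneg (h : IsVariationBound f W V) : 0 ≤ V := by
  linarith [h.add_one 0, h.monotone (show (0 : ℝ) ≤ 0 + 1 by norm_num)]

theorem abs_sub_le_of_mem (h : IsVariationBound f W V) {a b s t : ℝ} (hs : s ∈ Set.Icc a b)
    (ht : t ∈ Set.Icc a b) : |f t - f s| ≤ W b - W a := by
  have hm := h.monotone
  rcases le_total s t with hst | hst
  · linarith [h.abs_sub_le s t hst, hm ht.2, hm hs.1]
  · rw [abs_sub_comm]
    linarith [h.abs_sub_le t s hst, hm hs.2, hm ht.1]

theorem abs_sub_le_total (h : IsVariationBound f W V) (x y : UnitAddCircle) : |f x - f y| ≤ V := by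
  obtain ⟨s, rfl⟩ := QuotientAddGroup.mk_surjective x
  obtain ⟨t, rfl⟩ := QuotientAddGroup.mk_surjective y
  have h1 := h.abs_sub_le_of_mem (a := 0) (b := 0 + 1) (s := Int.fract t) (t := Int.fract s)
    ⟨Int.fract_nonneg _, by linarith [Int.fract_lt_one t]⟩
    ⟨Int.fract_nonneg _, by linarith [Int.fract_lt_one s]⟩
  rw [coe_fract, coe_fract, h.add_one] at h1
  simpa using h1

theorem exists_abs_le (h : IsVariationBound f W V) : ∃ M, 0 ≤ M ∧ ∀ x, |f x| ≤ M := by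
  refine ⟨V + |f 0|, add_nonneg h.nonneg (abs_nonneg _), fun x => ?_⟩
  have := h.abs_sub_le_total x 0
  have := abs_sub_abs_le_abs_sub (f x) (f 0)
  linarith

end IsVariationBound

/-! ### Variation over overlapping windows. -/

/-- Multiplication by `p` prime to `q`, followed by a shift, permutes the residues modulo `q`. -/
theorem sum_range_mul_add_of_periodic {M : Type*} [AddCommMonoid M] {G : ℤ → M} {q : ℕ} {p : ℤ}
    (hq : 0 < q) (hpq : IsCoprime p (q : ℤ)) (hG : ∀ m, G (m + q) = G m) (c : ℤ) :
    ∑ j ∈ Finset.range q, G (j * p + c) = ∑ i ∈ Finset.range q, G i := by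
  have hG' : ∀ m : ℤ, G (m % q) = G m := by
    have hper : Function.Periodic G (q : ℤ) := hG
    intro m
    conv_rhs => rw [← Int.emod_add_mul_ediv m q, mul_comm]
    exact (hper.int_mul (m / q) (m % q)).symm
  have hq' : (0 : ℤ) < q := by exact_mod_cast hq
  have hmod : ∀ m : ℤ, 0 ≤ m % q ∧ m % q < q := fun m =>
    ⟨Int.emod_nonneg _ hq'.ne', Int.emod_lt_of_pos _ hq'⟩
  have hmaps : ∀ j ∈ Finset.range q, (((j : ℤ) * p + c) % q).toNat ∈ Finset.range q := by
    intro j _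
    have := hmod (j * p + c)
    rw [Finset.mem_range]; omega
  have hinj : Set.InjOn (fun j : ℕ => (((j : ℤ) * p + c) % q).toNat) (Finset.range q) := by
    intro i hi j hj hij
    simp only [Finset.coe_range, Set.mem_Iio] at hi hj
    have h1 := hmod (i * p + c)
    have h2 := hmod (j * p + c)
    have h3 : ((i : ℤ) * p + c) % q = ((j : ℤ) * p + c) % q := by
      have hij' : (((i : ℤ) * p + c) % q).toNat = (((j : ℤ) * p + c) % q).toNat := hij
      omega
    have h4 : (q : ℤ) ∣ ((i : ℤ) - j) * p := by
      have := Int.ModEq.dvd (show ((j : ℤ) * p + c) ≡ ((i : ℤ) * p + c) [ZMOD q] from h3.symm)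
      convert this using 1; ring
    have h5 : (q : ℤ) ∣ (i : ℤ) - j := hpq.symm.dvd_of_dvd_mul_right h4
    have h6 := Int.eq_zero_of_abs_lt_dvd h5 (by rw [abs_lt]; omega)
    omega
  refine Finset.sum_nbij _ hmaps hinj
    (Finset.surjOn_of_injOn_of_card_le _ hmaps hinj le_rfl) fun j _ => ?_
  have := hmod (j * p + c)
  rw [Int.toNat_of_nonneg this.1, hG']

namespace IsVariationBound

variable {f : UnitAddCircle → ℝ} {W : ℝ → ℝ} {V : ℝ}

theorem sum_range_increment (h : IsVariationBound f W V) {q : ℕ} (hq : 0 < q) (y : ℝ) :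
    ∑ i ∈ Finset.range q, (W (y + (i + 1) / q) - W (y + i / q)) = V := by
  have := Finset.sum_range_sub (fun i : ℕ => W (y + i / q)) q
  push_cast at this
  rw [this, div_self (by positivity), h.add_one]
  simp

theorem sum_range_increment_five (h : IsVariationBound f W V) {q : ℕ} (hq : 0 < q) (y : ℝ) :
    ∑ i ∈ Finset.range q, (W (y + (i + 3) / q) - W (y + (i - 2) / q)) = 5 * V := by
  -- A window of width 5/q splits into five steps of width 1/q, at offsets c = −2, …, 2; each family
  -- of steps sums to one full turn.
  have e : ∀ c : ℝ,
      ∑ i ∈ Finset.range q, (W (y + (i + (c + 1)) / q) - W (y + (i + c) / q)) = V := by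
    intro c
    rw [← h.sum_range_increment hq (y + c / q)]
    refine Finset.sum_congr rfl fun i _ => ?_
    congr 2 <;> ring
  have e1 := e (-2)
  have e2 := e (-1)
  have e3 := e 0
  have e4 := e 1
  have e5 := e 2
  norm_num [Finset.sum_sub_distrib] at e1 e2 e3 e4 e5 ⊢
  simp only [← sub_eq_add_neg] at e1 e2
  linarith

/-- Reordering the residues jp mod q turns the windows into consecutive translates by 1/q, which
cover the circle five times. The margins −2 and 3 leave room for an offset in [−1/q, 2/q] plus a
Dirichlet error of 1/q. -/
theorem sum_abs_sub_le (h : IsVariationBound f W V) {q : ℕ} {p : ℤ} (hq : 0 < q)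
    (hpq : IsCoprime p (q : ℤ)) (y : ℝ) {a b : ℕ → ℝ}
    (ha : ∀ j < q, a j ∈ Set.Icc (y + (j * p - 2) / q) (y + (j * p + 3) / q))
    (hb : ∀ j < q, b j ∈ Set.Icc (y + (j * p - 2) / q) (y + (j * p + 3) / q)) :
    ∑ j ∈ Finset.range q, |f (a j) - f (b j)| ≤ 5 * V := by
  set G : ℤ → ℝ := fun m => W (y + (m + 3) / q) - W (y + (m - 2) / q) with hG
  have hqr : (0 : ℝ) < q := by exact_mod_cast hq
  have hper : ∀ m, G (m + q) = G m := by
    intro m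
    simp only [hG]
    rw [show y + (((m + q : ℤ) : ℝ) + 3) / q = y + (m + 3) / q + 1 by push_cast; field_simp; ring,
      show y + (((m + q : ℤ) : ℝ) - 2) / q = y + (m - 2) / q + 1 by push_cast; field_simp; ring,
      h.add_one, h.add_one]
    ring
  have h1 := sum_range_mul_add_of_periodic hq hpq hper 0
  have h2 := h.sum_range_increment_five hq y
  calc ∑ j ∈ Finset.range q, |f (a j) - f (b j)|
      ≤ ∑ j ∈ Finset.range q, G (j * p + 0) := by
        refine Finset.sum_le_sum fun j hj => ?_
        have hj' := Finset.mem_range.mp hj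
        simp only [hG]
        push_cast
        rw [add_zero]
        exact h.abs_sub_le_of_mem (hb j hj') (ha j hj')
    _ = 5 * V := by rw [h1, ← h2]; simp [hG]

end IsVariationBound

/-! ### Measurability and continuity. -/

/-- The preimage of an open set differs from its interior only by discontinuity points. -/
theorem measurable_of_countable_not_continuousAt {X Y : Type*} [TopologicalSpace X]
    [MeasurableSpace X] [BorelSpace X] [MeasurableSingletonClass X] [TopologicalSpace Y]
    [MeasurableSpace Y] [BorelSpace Y] {f : X → Y} (hf : {x | ¬ContinuousAt f x}.Countable) :
    Measurable f := by
  refine measurable_of_isOpen fun U hU => ?_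
  have h1 : f ⁻¹' U = interior (f ⁻¹' U) ∪ (f ⁻¹' U \ interior (f ⁻¹' U)) :=
    (Set.union_sdiff_cancel interior_subset).symm
  have h2 : (f ⁻¹' U \ interior (f ⁻¹' U)).Countable := by
    refine Set.Countable.mono (s₂ := {x | ¬ContinuousAt f x}) (fun x hx hc => hx.2 ?_) hf
    exact mem_interior_iff_mem_nhds.mpr (ContinuousAt.preimage_mem_nhds hc (hU.mem_nhds hx.1))
  rw [h1]
  exact isOpen_interior.measurableSet.union h2.measurableSet

theorem continuousAt_coe_of_lift {f : UnitAddCircle → ℝ} {t : ℝ}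
    (h : ContinuousAt (fun s : ℝ => f s) t) : ContinuousAt f t := by
  have hopen : IsOpenMap ((↑) : ℝ → UnitAddCircle) := QuotientAddGroup.isOpenMap_coe
  rw [ContinuousAt]
  refine Tendsto.mono_left ?_ (hopen.nhds_le t)
  exact h

/-! ### Rational approximation and the rotation cocycle. -/

/-- Denominators of the rational approximations of `θ` given by Dirichlet's theorem. -/
structure IsDirichletApprox (θ : ℝ) (p : ℤ) (q : ℕ) : Prop where
  pos : 0 < q
  isCoprime : IsCoprime p (q : ℤ)
  abs_sub_le : |θ - p / q| ≤ 1 / (q : ℝ) ^ 2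

theorem IsDirichletApprox.abs_mul_sub_le {θ : ℝ} {p : ℤ} {q : ℕ} (h : IsDirichletApprox θ p q)
    {j : ℕ} (hj : j ≤ q) : |j * θ - j * p / q| ≤ 1 / q := by
  have hq : (0 : ℝ) < q := by exact_mod_cast h.pos
  have hj' : (j : ℝ) ≤ q := by exact_mod_cast hj
  calc |j * θ - j * p / q| = j * |θ - p / q| := by
        rw [← abs_of_nonneg (Nat.cast_nonneg (α := ℝ) j), ← abs_mul,
          abs_of_nonneg (Nat.cast_nonneg (α := ℝ) j)]
        congr 1; ring
    _ ≤ q * (1 / (q : ℝ) ^ 2) :=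
        mul_le_mul hj' h.abs_sub_le (abs_nonneg _) hq.le
    _ = 1 / q := by field_simp

/-- If the denominators were bounded by B, the numerators would be bounded by ⌈B(|θ| + 1)⌉, leaving
finitely many fractions against Dirichlet's theorem. -/
theorem infinite_isDirichletApprox {θ : ℝ} (hθ : Irrational θ) :
    {q : ℕ | ∃ p, IsDirichletApprox θ p q}.Infinite := by
  have h1 := Real.infinite_rat_abs_sub_lt_one_div_den_sq_of_irrational hθ
  intro hfin
  refine h1 ?_
  obtain ⟨B, hB⟩ := hfin.bddAbove
  have hmem : ∀ r : ℚ, |θ - r| < 1 / (r.den : ℝ) ^ 2 → IsDirichletApprox θ r.num r.den := by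
    intro r hr
    refine ⟨r.den_pos, Int.isCoprime_iff_gcd_eq_one.mpr r.reduced, ?_⟩
    rw [Rat.cast_def] at hr
    exact hr.le
  have hfin2 : ((fun z : ℤ × ℕ => (z.1 : ℚ) / z.2) ''
      (Set.Icc (-(⌈(B : ℝ) * (|θ| + 1)⌉)) ⌈(B : ℝ) * (|θ| + 1)⌉ ×ˢ Set.Iic B)).Finite :=
    ((Set.finite_Icc _ _).prod (Set.finite_Iic _)).image _
  refine hfin2.subset fun r hr => ⟨(r.num, r.den), ⟨?_, ?_⟩, Rat.num_div_den r⟩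
  · have hd : r.den ≤ B := hB ⟨_, hmem r hr⟩
    have hdB : (r.den : ℝ) ≤ B := by exact_mod_cast hd
    have hd1 : (1 : ℝ) ≤ r.den := by exact_mod_cast r.den_pos
    have h2 : |(r : ℝ)| ≤ |θ| + 1 := by
      have h3 : 1 / (r.den : ℝ) ^ 2 ≤ 1 := by
        rw [div_le_one (by positivity)]; nlinarith
      have hr' : |θ - r| < 1 / (r.den : ℝ) ^ 2 := hr
      have := abs_sub_abs_le_abs_sub (r : ℝ) θ
      rw [abs_sub_comm] at this
      linarith
    have h4 : |(r.num : ℝ)| ≤ B * (|θ| + 1) := by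
      have : (r.num : ℝ) = r.den * r := by
        rw [Rat.cast_def]; field_simp
      rw [this, abs_mul, abs_of_nonneg (by positivity)]
      exact mul_le_mul hdB h2 (abs_nonneg _) (by positivity)
    have h5 : |(r.num : ℝ)| ≤ (⌈(B : ℝ) * (|θ| + 1)⌉ : ℤ) := h4.trans (Int.le_ceil _)
    have h6 : |r.num| ≤ ⌈(B : ℝ) * (|θ| + 1)⌉ := by exact_mod_cast h5
    exact abs_le.mp h6
  · exact hB ⟨_, hmem r hr⟩

theorem rot_iterate (θ : ℝ) (k : ℕ) (x : UnitAddCircle) :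
    (rot θ)^[k] x = x + ((k * θ : ℝ) : UnitAddCircle) := by
  induction k with
  | zero => simp
  | succ k ih =>
    rw [Function.iterate_succ_apply', ih, rot, add_assoc, ← AddCircle.coe_add]
    push_cast; congr 2; ring

theorem continuous_rot (θ : ℝ) : Continuous (rot θ) := by unfold rot; fun_prop

theorem continuous_rotInv (θ : ℝ) : Continuous (rotInv θ) := by unfold rotInv; fun_prop

theorem rotInv_rot (θ : ℝ) (x : UnitAddCircle) : rotInv θ (rot θ x) = x := by simp [rot, rotInv]

theorem rot_rotInv (θ : ℝ) (x : UnitAddCircle) : rot θ (rotInv θ x) = x := by simp [rot, rotInv]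

theorem rho_pos (θ : ℝ) (f : UnitAddCircle → ℝ) (n : ℕ) (x : UnitAddCircle) : 0 < rho θ f n x :=
  Real.exp_pos _

theorem rho_add (θ : ℝ) (f : UnitAddCircle → ℝ) (m n : ℕ) (x : UnitAddCircle) :
    rho θ f (m + n) x = rho θ f m x * rho θ f n ((rot θ)^[m] x) := by
  rw [rho, birkhoffSum_add, Real.exp_add]; rfl

theorem isProbabilityMeasure_volume : IsProbabilityMeasure (volume : Measure UnitAddCircle) :=
  ⟨UnitAddCircle.measure_univ⟩

/-! ### The Denjoy–Koksma inequality. -/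

namespace IsVariationBound

variable {f : UnitAddCircle → ℝ} {W : ℝ → ℝ} {V : ℝ}

theorem continuousAt_lift (h : IsVariationBound f W V) {t : ℝ} (ht : ContinuousAt W t) :
    ContinuousAt (fun s : ℝ => f s) t := by
  rw [ContinuousAt, tendsto_iff_dist_tendsto_zero] at ht ⊢
  refine squeeze_zero (fun _ => dist_nonneg) (fun s => ?_) ht
  rw [Real.dist_eq, Real.dist_eq]
  rcases le_total s t with hst | hst
  · rw [abs_sub_comm, abs_sub_comm (W s)]
    exact (h.abs_sub_le s t hst).trans (le_abs_self _)
  · exact (h.abs_sub_le t s hst).trans (le_abs_self _)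

/-- Every discontinuity lies below one of the monotone function W. This yields measurability and,
for non-atomic measures, continuity almost everywhere. -/
theorem countable_not_continuousAt (h : IsVariationBound f W V) :
    {x | ¬ContinuousAt f x}.Countable := by
  refine (h.monotone.countable_not_continuousAt.image ((↑) : ℝ → UnitAddCircle)).mono
    fun x hx => ?_
  obtain ⟨t, rfl⟩ := QuotientAddGroup.mk_surjective x
  exact ⟨t, fun ht => hx (continuousAt_coe_of_lift (h.continuousAt_lift ht)), rfl⟩

theorem measurable (h : IsVariationBound f W V) : Measurable f :=
  measurable_of_countable_not_continuousAt h.countable_not_continuousAt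

theorem integrable (h : IsVariationBound f W V) (μ : Measure UnitAddCircle) [IsFiniteMeasure μ] :
    Integrable f μ := by
  obtain ⟨M, -, hM⟩ := h.exists_abs_le
  exact Integrable.of_bound h.measurable.aestronglyMeasurable M (ae_of_all _ hM)

/-- The Denjoy–Koksma inequality. -/
theorem abs_birkhoffSum_le (h : IsVariationBound f W V) (hf0 : ∫ x, f x = 0) {θ : ℝ} {p : ℤ}
    {q : ℕ} (hpq : IsDirichletApprox θ p q) (x : UnitAddCircle) :
    |birkhoffSum (rot θ) f q x| ≤ 5 * V := by
  have := isProbabilityMeasure_volume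
  have hq : (0 : ℝ) < q := by exact_mod_cast hpq.pos
  -- Φ has mean zero, so a bound on the difference that is uniform in y survives averaging over y
  -- and bounds the Birkhoff sum itself.
  set Φ : UnitAddCircle → ℝ :=
    fun y => ∑ j ∈ Finset.range q, f (y + ((j * p / q : ℝ) : UnitAddCircle)) with hΦ
  have hint : ∀ c : UnitAddCircle, Integrable (fun y => f (y + c)) := fun c =>
    (h.integrable volume).comp_add_right c
  have hΦ0 : ∫ y, Φ y = 0 := by
    simp only [hΦ]
    rw [integral_finsetSum _ fun j _ => hint _]
    exact Finset.sum_eq_zero fun j _ => by rw [integral_add_right_eq_self f, hf0]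
  have hΦint : Integrable Φ := integrable_finsetSum _ fun j _ => hint _
  have key : ∀ y, |birkhoffSum (rot θ) f q x - Φ y| ≤ 5 * V := by
    intro y
    obtain ⟨u, rfl⟩ := QuotientAddGroup.mk_surjective x
    obtain ⟨v, rfl⟩ := QuotientAddGroup.mk_surjective y
    -- The integer part m of q(v − u) only permutes the terms of Φ(v); the fractional part s keeps
    -- the points within 1/q of the rational orbit of u.
    set s := Int.fract (q * (v - u)) with hs
    set m := ⌊q * (v - u)⌋ with hm
    have hs0 : 0 ≤ s := Int.fract_nonneg _
    have hs1 : s < 1 := Int.fract_lt_one _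
    have hv : v = u + (m + s) / q := by
      rw [Int.floor_add_fract]; field_simp; ring
    set G : ℤ → ℝ := fun k => f ((u + (k + s) / q : ℝ) : UnitAddCircle) with hG
    have hper : ∀ k, G (k + q) = G k := by
      intro k
      simp only [hG]
      rw [← coe_add_intCast (u + (k + s) / q) 1]
      congr 2; push_cast; field_simp; ring
    have e1 := sum_range_mul_add_of_periodic hpq.pos hpq.isCoprime hper m
    have e2 := sum_range_mul_add_of_periodic hpq.pos hpq.isCoprime hper 0
    have e3 : Φ (v : UnitAddCircle) =
        ∑ j ∈ Finset.range q, f ((u + (j * p + s) / q : ℝ) : UnitAddCircle) := by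
      trans ∑ j ∈ Finset.range q, G (j * p + m)
      · refine Finset.sum_congr rfl fun j _ => ?_
        simp only [hG]
        rw [← AddCircle.coe_add]
        congr 2
        nth_rw 1 [hv]
        push_cast; ring
      · rw [e1, ← e2]
        refine Finset.sum_congr rfl fun j _ => ?_
        simp only [hG]
        congr 2
        push_cast; ring
    change |birkhoffSum (rot θ) f q (u : UnitAddCircle) - Φ (v : UnitAddCircle)| ≤ _
    rw [e3, birkhoffSum, ← Finset.sum_sub_distrib]
    refine (Finset.abs_sum_le_sum_abs _ _).trans ?_
    have e4 := h.sum_abs_sub_le hpq.pos hpq.isCoprime u (a := fun j => u + j * θ)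
      (b := fun j => u + (j * p + s) / q) (fun j hj => ?_) (fun j hj => ?_)
    · refine le_of_eq_of_le (Finset.sum_congr rfl fun j _ => ?_) e4
      rw [rot_iterate, ← AddCircle.coe_add]
    · have e5 := abs_le.mp (hpq.abs_mul_sub_le hj.le)
      have e6 : (0 : ℝ) < 1 / q := by positivity
      rw [sub_div, add_div, show (2 : ℝ) / q = 2 * (1 / q) by ring,
        show (3 : ℝ) / q = 3 * (1 / q) by ring]
      constructor <;> linarith
    · constructor
      · gcongr; linarith
      · gcongr; linarith
  have e : birkhoffSum (rot θ) f q x = ∫ y, (birkhoffSum (rot θ) f q x - Φ y) := by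
    rw [integral_sub (integrable_const _) hΦint, hΦ0]; simp
  rw [e]
  simpa using norm_integral_le_of_norm_le_const (μ := (volume : Measure UnitAddCircle))
    (f := fun y => birkhoffSum (rot θ) f q x - Φ y) (ae_of_all _ key)

theorem one_div_rho_add_comparable (h : IsVariationBound f W V) (hf0 : ∫ x, f x = 0) {θ : ℝ} {p : ℤ}
    {q : ℕ} (hpq : IsDirichletApprox θ p q) (k : ℕ) (x : UnitAddCircle) :
    1 / rho θ f k x ≤ Real.exp (5 * V) * (1 / rho θ f (k + q) x) ∧
      1 / rho θ f (k + q) x ≤ Real.exp (5 * V) * (1 / rho θ f k x) := by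
  have h1 := abs_le.mp (h.abs_birkhoffSum_le hf0 hpq ((rot θ)^[k] x))
  simp only [rho, birkhoffSum_add, one_div, ← Real.exp_neg, ← Real.exp_add]
  constructor <;> apply Real.exp_le_exp.mpr <;> linarith

end IsVariationBound

/-! ### Orbit measures of small balls. -/

theorem integral_orbitMeasure (θ : ℝ) (f : UnitAddCircle → ℝ) (n : ℕ) (x : UnitAddCircle)
    (h : UnitAddCircle → ℝ) : ∫ y, h y ∂(orbitMeasure θ f n x) = weightedAvg θ f n h x := by
  have hS := wsum_pos θ f n x
  rw [orbitMeasure, integral_smul_measure, integral_finsetSum_measure]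
  · simp only [integral_smul_measure, integral_dirac]
    rw [ENNReal.toReal_ofReal (one_div_pos.mpr hS).le, weightedAvg, smul_eq_mul,
      div_mul_eq_mul_div, one_mul]
    congr 1
    refine Finset.sum_congr rfl fun k _ => ?_
    rw [ENNReal.toReal_ofReal (one_div_pos.mpr (rho_pos θ f k x)).le, smul_eq_mul,
      div_mul_eq_mul_div, one_mul]
  · intro k _
    exact (integrable_dirac (by simp)).smul_measure ENNReal.ofReal_ne_top

theorem orbitMeasure_real (θ : ℝ) (f : UnitAddCircle → ℝ) (n : ℕ) (x : UnitAddCircle)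
    {B : Set UnitAddCircle} [DecidablePred (· ∈ B)] (hB : MeasurableSet B) :
    (orbitMeasure θ f n x).real B =
      (∑ k ∈ (Finset.range (n + 1)).filter (fun k => (rot θ)^[k] x ∈ B), 1 / rho θ f k x)
        / wsum θ f n x := by
  rw [← integral_indicator_one hB, integral_orbitMeasure, weightedAvg, Finset.sum_filter]
  congr 1
  refine Finset.sum_congr rfl fun k _ => ?_
  by_cases hk : (rot θ)^[k] x ∈ B <;> simp [hk]

/-- Double counting: each weight on K is charged to `Q.card` distinct places of R, at a cost of C
each time. -/
theorem card_mul_sum_le_of_injOn {w : ℕ → ℝ} (hw : ∀ k, 0 ≤ w k) {C : ℝ} (hC : 0 ≤ C)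
    {K Q R : Finset ℕ} (σ : ℕ × ℕ → ℕ) (hσ : Set.InjOn σ (K ×ˢ Q : Finset (ℕ × ℕ)))
    (hR : ∀ z ∈ K ×ˢ Q, σ z ∈ R) (hle : ∀ z ∈ K ×ˢ Q, w z.1 ≤ C * w (σ z)) :
    Q.card * ∑ k ∈ K, w k ≤ C * ∑ k ∈ R, w k := by
  calc (Q.card : ℝ) * ∑ k ∈ K, w k = ∑ z ∈ K ×ˢ Q, w z.1 := by
        rw [Finset.sum_product]; simp [Finset.mul_sum]
    _ ≤ ∑ z ∈ K ×ˢ Q, C * w (σ z) := Finset.sum_le_sum hle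
    _ = C * ∑ k ∈ (K ×ˢ Q).image σ, w k := by rw [Finset.sum_image hσ, Finset.mul_sum]
    _ ≤ C * ∑ k ∈ R, w k := by
        refine mul_le_mul_of_nonneg_left ?_ hC
        refine Finset.sum_le_sum_of_subset_of_nonneg ?_ fun k _ _ => hw k
        intro k hk
        obtain ⟨z, hz, rfl⟩ := Finset.mem_image.mp hk
        exact hR z hz

theorem norm_coe_intCast_mul_pos {θ : ℝ} (hθ : Irrational θ) {m : ℤ} (hm : m ≠ 0) :
    0 < ‖((m * θ : ℝ) : UnitAddCircle)‖ := by
  rw [norm_pos_iff]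
  intro h
  obtain ⟨n, hn⟩ := (AddCircle.coe_eq_zero_iff (1 : ℝ)).mp h
  refine (hθ.intCast_mul hm).ne_int n ?_
  rw [← hn]; simp

theorem exists_radius {θ : ℝ} (hθ : Irrational θ) (Q : Finset ℕ) :
    ∃ r : ℝ, 0 < r ∧ ∀ q ∈ Q, ∀ q' ∈ Q, q ≠ q' →
      2 * r ≤ ‖((((q : ℤ) - q' : ℤ) * θ : ℝ) : UnitAddCircle)‖ := by
  have h1 : ∀ᶠ r : ℝ in 𝓝[>] 0, ∀ q ∈ Q, ∀ q' ∈ Q, q ≠ q' →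
      2 * r ≤ ‖((((q : ℤ) - q' : ℤ) * θ : ℝ) : UnitAddCircle)‖ := by
    rw [eventually_all_finset]
    intro q _
    rw [eventually_all_finset]
    intro q' _
    by_cases hqq : q = q'
    · simp [hqq]
    · have hpos := norm_coe_intCast_mul_pos hθ (m := (q : ℤ) - q') (by omega)
      have : ∀ᶠ r : ℝ in 𝓝[>] 0, r < ‖((((q : ℤ) - q' : ℤ) * θ : ℝ) : UnitAddCircle)‖ / 2 :=
        mem_nhdsWithin_of_mem_nhds (Iio_mem_nhds (by positivity))
      filter_upwards [this] with r hr _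
      linarith
  obtain ⟨r, hr, hr0⟩ := (h1.and self_mem_nhdsWithin).exists
  exact ⟨r, hr0, hr⟩

theorem norm_lt_of_iterate_mem_ball {θ : ℝ} {x a : UnitAddCircle} {r : ℝ} {k k' : ℕ}
    (hk : (rot θ)^[k] x ∈ Metric.ball a r) (hk' : (rot θ)^[k'] x ∈ Metric.ball a r) {m : ℤ}
    (hm : m = (k : ℤ) - k') : ‖((m * θ : ℝ) : UnitAddCircle)‖ < 2 * r := by
  have h1 : ((m * θ : ℝ) : UnitAddCircle) = (rot θ)^[k] x - (rot θ)^[k'] x := by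
    rw [rot_iterate, rot_iterate, add_sub_add_left_eq_sub, ← AddCircle.coe_sub, hm]
    push_cast; congr 1; ring
  rw [h1, ← dist_eq_norm]
  have := dist_triangle_right ((rot θ)^[k] x) ((rot θ)^[k'] x) a
  rw [Metric.mem_ball] at hk hk'
  linarith

theorem IsVariationBound.exists_radius_orbitMeasure_le {f : UnitAddCircle → ℝ} {W : ℝ → ℝ} {V : ℝ}
    (h : IsVariationBound f W V) (hf0 : ∫ x, f x = 0) {θ : ℝ} (hθ : Irrational θ) {ε : ℝ}
    (hε : 0 < ε) :
    ∃ r : ℝ, 0 < r ∧ ∃ N₀ : ℕ, ∀ N ≥ N₀, ∀ x a : UnitAddCircle,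
      (orbitMeasure θ f N x).real (Metric.ball a r) ≤ ε := by
  classical
  set C := Real.exp (5 * V) with hC
  have hC0 : 0 < C := Real.exp_pos _
  -- Early and late times each contribute at most C/J, whence the factor 2.
  obtain ⟨J, hJ⟩ := exists_nat_gt (2 * C / ε)
  obtain ⟨Q, hQ, hQJ⟩ := (infinite_isDirichletApprox hθ).exists_subset_card_eq J
  obtain ⟨r, hr, hrQ⟩ := exists_radius hθ Q
  -- Visits up to N/2 are shifted forward and later ones backward; N ≥ 2 max Q keeps all shifted
  -- times between 0 and N.
  refine ⟨r, hr, 2 * Q.sup id, fun N hN x a => ?_⟩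
  have hsup : ∀ q ∈ Q, q ≤ Q.sup id := fun q hq => Finset.le_sup (f := id) hq
  set w : ℕ → ℝ := fun k => 1 / rho θ f k x with hw
  have hw0 : ∀ k, 0 ≤ w k := fun k => (one_div_pos.mpr (rho_pos θ f k x)).le
  have hS := wsum_pos θ f N x
  set S := wsum θ f N x with hSdef
  have hSw : S = ∑ k ∈ Finset.range (N + 1), w k := rfl
  set K := (Finset.range (N + 1)).filter (fun k => (rot θ)^[k] x ∈ Metric.ball a r) with hK
  -- A collision of shifted times makes (q − q')θ the displacement between two visits to the ball,
  -- hence shorter than 2r; the choice of r then forces q = q'.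
  have hinj : ∀ k ∈ K, ∀ k' ∈ K, ∀ q ∈ Q, ∀ q' ∈ Q, (q : ℤ) - q' = k' - k → q = q' := by
    intro k hk k' hk' q hq q' hq' he
    by_contra hne
    have h1 := norm_lt_of_iterate_mem_ball (Finset.mem_filter.mp hk').2 (Finset.mem_filter.mp hk).2
      (m := (q : ℤ) - q') he
    exact absurd h1 (not_lt.mpr (hrQ q hq q' hq' hne))
  have hcmp : ∀ q ∈ Q, ∀ k, w k ≤ C * w (k + q) ∧ w (k + q) ≤ C * w k := by
    intro q hq k
    obtain ⟨p, hp⟩ := hQ hq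
    exact h.one_div_rho_add_comparable hf0 hp k x
  have hlow : (Q.card : ℝ) * ∑ k ∈ K.filter (fun k => 2 * k ≤ N), w k ≤ C * S := by
    refine card_mul_sum_le_of_injOn hw0 hC0.le (fun z => z.1 + z.2) ?_ ?_ ?_
    · rintro ⟨k, q⟩ hz ⟨k', q'⟩ hz' he
      simp only [Finset.coe_product, Set.mem_prod, Finset.mem_coe] at hz hz' he
      have h1 := hinj k (Finset.mem_filter.mp hz.1).1 k' (Finset.mem_filter.mp hz'.1).1 q hz.2 q'
        hz'.2 (by omega)
      rw [Prod.mk.injEq]; omega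
    · rintro ⟨k, q⟩ hz
      have hz' := Finset.mem_product.mp hz
      have h1 := (Finset.mem_filter.mp hz'.1).2
      have h2 := hsup q hz'.2
      rw [Finset.mem_range]
      simp only at h1 h2 ⊢
      omega
    · rintro ⟨k, q⟩ hz
      exact (hcmp q (Finset.mem_product.mp hz).2 k).1
  have hhigh : (Q.card : ℝ) * ∑ k ∈ K.filter (fun k => ¬2 * k ≤ N), w k ≤ C * S := by
    have hle : ∀ k q, k ∈ K.filter (fun k => ¬2 * k ≤ N) → q ∈ Q → q ≤ k := by
      intro k q hk hq
      have h1 := (Finset.mem_filter.mp hk).2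
      have h2 := hsup q hq
      omega
    refine card_mul_sum_le_of_injOn hw0 hC0.le (fun z => z.1 - z.2) ?_ ?_ ?_
    · rintro ⟨k, q⟩ hz ⟨k', q'⟩ hz' he
      simp only [Finset.coe_product, Set.mem_prod, Finset.mem_coe] at hz hz' he
      have h2 := hle _ _ hz.1 hz.2
      have h3 := hle _ _ hz'.1 hz'.2
      have h1 := hinj k' (Finset.mem_filter.mp hz'.1).1 k (Finset.mem_filter.mp hz.1).1 q hz.2 q'
        hz'.2 (by omega)
      rw [Prod.mk.injEq]; omega
    · rintro ⟨k, q⟩ hz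
      have hz' := Finset.mem_product.mp hz
      have h1 := Finset.mem_range.mp (Finset.mem_filter.mp (Finset.mem_filter.mp hz'.1).1).1
      rw [Finset.mem_range]
      simp only at h1 ⊢
      omega
    · rintro ⟨k, q⟩ hz
      have hz' := Finset.mem_product.mp hz
      have h2 := hle _ _ hz'.1 hz'.2
      have h3 := (hcmp q hz'.2 (k - q)).2
      simp only at h2 h3 ⊢
      rwa [Nat.sub_add_cancel h2] at h3
  rw [orbitMeasure_real θ f N x Metric.isOpen_ball.measurableSet, div_le_iff₀ hS]
  rw [← hK]
  change ∑ k ∈ K, w k ≤ _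
  rw [← Finset.sum_filter_add_sum_filter_not K (fun k => 2 * k ≤ N)]
  rw [hQJ] at hlow hhigh
  have hJ0 : (0 : ℝ) < J := lt_of_le_of_lt (by positivity) hJ
  have hJε : 2 * C ≤ ε * J := by
    rw [div_lt_iff₀ hε] at hJ; linarith
  have h4 : 2 * C * S ≤ ε * J * S := mul_le_mul_of_nonneg_right hJε hS.le
  refine le_of_mul_le_mul_left ?_ hJ0
  linarith

/-- The weight of each single time of the orbit tends to zero. -/
theorem IsVariationBound.exists_forall_weight_le {f : UnitAddCircle → ℝ} {W : ℝ → ℝ} {V : ℝ}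
    (h : IsVariationBound f W V) (hf0 : ∫ x, f x = 0) {θ : ℝ} (hθ : Irrational θ) {ε : ℝ}
    (hε : 0 < ε) :
    ∃ N₀ : ℕ, ∀ N ≥ N₀, ∀ x : UnitAddCircle, ∀ k ≤ N,
      1 / rho θ f k x / wsum θ f N x ≤ ε := by
  classical
  obtain ⟨r, hr, N₀, hN₀⟩ := h.exists_radius_orbitMeasure_le hf0 hθ hε
  -- The ball around the point visited at time k carries at least the weight of that time.
  refine ⟨N₀, fun N hN x k hk => le_trans ?_ (hN₀ N hN x ((rot θ)^[k] x))⟩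
  rw [orbitMeasure_real θ f N x Metric.isOpen_ball.measurableSet]
  refine div_le_div_of_nonneg_right ?_ (wsum_pos θ f N x).le
  refine Finset.single_le_sum (f := fun k => 1 / rho θ f k x)
    (fun k _ => (one_div_pos.mpr (rho_pos θ f k x)).le) ?_
  simp only [Finset.mem_filter, Finset.mem_range]
  exact ⟨by omega, Metric.mem_ball_self hr⟩

/-! ### Weak convergence against almost everywhere continuous functions. -/

theorem frontier_setOf_le_subset {X : Type*} [TopologicalSpace X] (h : X → ℝ) (t : ℝ) :
    frontier {x | t ≤ h x} ⊆ {x | ¬ContinuousAt h x} ∪ {x | h x = t} := by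
  intro x hx
  by_contra hcon
  simp only [Set.mem_union, Set.mem_ofPred_eq, not_or, not_not] at hcon
  obtain ⟨hc, hne⟩ := hcon
  rcases lt_or_gt_of_ne hne with hlt | hgt
  · have : ∀ᶠ y in 𝓝 x, h y < t := hc.eventually (Iio_mem_nhds hlt)
    have h2 := mem_closure_iff_frequently.mp hx.1
    obtain ⟨y, hy1, hy2⟩ := (h2.and_eventually this).exists
    exact absurd hy1 (not_le.mpr hy2)
  · have : ∀ᶠ y in 𝓝 x, t < h y := hc.eventually (Ioi_mem_nhds hgt)
    exact hx.2 (mem_interior_iff_mem_nhds.mpr (this.mono fun y hy => hy.le))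

section WeakConvergence

variable {X : Type*} [TopologicalSpace X] [MeasurableSpace X] [BorelSpace X]
  [HasOuterApproxClosed X]

/-- By the layer-cake formula it suffices that superlevel sets converge in measure for almost every
level. All but countably many levels are null for μ, and there the superlevel set has null frontier.
-/
theorem tendsto_integral_of_ae_continuousAt_of_nonneg {μs : ℕ → ProbabilityMeasure X}
    {μ : ProbabilityMeasure X} (hμ : Tendsto μs atTop (𝓝 μ)) {h : X → ℝ} (hm : Measurable h)
    {M : ℝ} (h0 : ∀ x, 0 ≤ h x) (hM : ∀ x, h x ≤ M)
    (hc : ∀ᵐ x ∂(μ : Measure X), ContinuousAt h x) :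
    Tendsto (fun n => ∫ x, h x ∂(μs n : Measure X)) atTop (𝓝 (∫ x, h x ∂(μ : Measure X))) := by
  have hint : ∀ ν : ProbabilityMeasure X, Integrable h (ν : Measure X) := fun ν =>
    Integrable.of_bound hm.aestronglyMeasurable M
      (ae_of_all _ fun x => by rw [Real.norm_eq_abs, abs_of_nonneg (h0 x)]; exact hM x)
  have hlayer : ∀ ν : ProbabilityMeasure X, ∫ x, h x ∂(ν : Measure X)
      = ∫ t in Set.Ioc 0 M, (ν : Measure X).real {x | t ≤ h x} := fun ν =>
    (hint ν).integral_eq_integral_Ioc_meas_le (ae_of_all _ h0) (ae_of_all _ hM)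
  simp only [hlayer]
  refine tendsto_integral_of_dominated_convergence (fun _ => 1) (fun n => ?_)
    (integrable_const _) (fun n => ae_of_all _ fun t => ?_) ?_
  · refine Measurable.aestronglyMeasurable (Antitone.measurable fun s t hst => ?_)
    exact measureReal_mono fun x hx => le_trans hst hx
  · rw [Real.norm_eq_abs, abs_of_nonneg measureReal_nonneg]
    exact measureReal_le_one
  · refine ae_restrict_of_ae ?_
    have hcount := Measure.countable_meas_level_set_pos (μ := (μ : Measure X)) hm
    filter_upwards [hcount.ae_notMem volume] with t ht
    have ht' : (μ : Measure X) {x | h x = t} = 0 := by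
      simpa [pos_iff_ne_zero] using ht
    have hfr : (μ : Measure X) (frontier {x | t ≤ h x}) = 0 :=
      measure_mono_null (frontier_setOf_le_subset h t) (measure_union_null hc ht')
    exact (ENNReal.tendsto_toReal (measure_ne_top _ _)).comp
      (ProbabilityMeasure.tendsto_measure_of_null_frontier_of_tendsto' hμ hfr)

/-- Weak convergence of probability measures passes to bounded functions that are continuous
almost everywhere for the limit. -/
theorem tendsto_integral_of_ae_continuousAt {μs : ℕ → ProbabilityMeasure X}
    {μ : ProbabilityMeasure X} (hμ : Tendsto μs atTop (𝓝 μ)) {h : X → ℝ} (hm : Measurable h)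
    {M : ℝ} (hM : ∀ x, |h x| ≤ M) (hc : ∀ᵐ x ∂(μ : Measure X), ContinuousAt h x) :
    Tendsto (fun n => ∫ x, h x ∂(μs n : Measure X)) atTop (𝓝 (∫ x, h x ∂(μ : Measure X))) := by
  have hint : ∀ ν : ProbabilityMeasure X, Integrable h (ν : Measure X) := fun ν =>
    Integrable.of_bound hm.aestronglyMeasurable M (ae_of_all _ hM)
  have h1 := tendsto_integral_of_ae_continuousAt_of_nonneg hμ (h := fun x => h x + M)
    (hm.add_const M) (M := M + M) (fun x => by linarith [(abs_le.mp (hM x)).1])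
    (fun x => by linarith [(abs_le.mp (hM x)).2])
    (hc.mono fun x hx => hx.add continuousAt_const)
  have h2 : ∀ ν : ProbabilityMeasure X, ∫ x, h x + M ∂(ν : Measure X)
      = ∫ x, h x ∂(ν : Measure X) + M := fun ν => by
    rw [integral_add (hint ν) (integrable_const _)]; simp
  simp only [h2] at h1
  simpa using h1.sub_const M

end WeakConvergence

/-! ### Limits of orbit measures. -/

/-- The orbit measures are almost solutions of the quasi-invariance equation. -/
theorem weightedAvg_comp_rot_sub (θ : ℝ) (f φ : UnitAddCircle → ℝ) (n : ℕ) (x : UnitAddCircle) :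
    weightedAvg θ f n (fun y => φ (rot θ y)) x
      - weightedAvg θ f n (fun y => Real.exp (f (rotInv θ y)) * φ y) x =
    φ ((rot θ)^[n + 1] x) * (1 / rho θ f n x / wsum θ f n x)
      - Real.exp (f (rotInv θ x)) * φ x * (1 / rho θ f 0 x / wsum θ f n x) := by
  rw [weightedAvg, weightedAvg, ← sub_div, Finset.sum_range_succ, Finset.sum_range_succ']
  -- Term k + 1 of the second sum equals term k of the first, so only the last term of the first and
  -- the initial term of the second remain.
  have key : ∀ k, Real.exp (f (rotInv θ ((rot θ)^[k + 1] x))) * φ ((rot θ)^[k + 1] x)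
      / rho θ f (k + 1) x = φ (rot θ ((rot θ)^[k] x)) / rho θ f k x := by
    intro k
    have h1 : rho θ f (k + 1) x = rho θ f k x * Real.exp (f ((rot θ)^[k] x)) := by
      rw [rho_add]; simp [rho]
    have := (rho_pos θ f k x).ne'
    rw [Function.iterate_succ_apply', rotInv_rot, h1]
    field_simp
  simp only [key, Function.iterate_zero, id]
  rw [Function.iterate_succ_apply']
  ring

theorem isQuasiInvariant_of_forall_integral_eq {θ : ℝ} {f : UnitAddCircle → ℝ}
    {μ : ProbabilityMeasure UnitAddCircle} (hf : Measurable f) {M : ℝ} (hM : ∀ x, |f x| ≤ M)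
    (h : ∀ φ : BoundedContinuousFunction UnitAddCircle ℝ,
      ∫ y, φ (rot θ y) ∂(μ : Measure UnitAddCircle)
        = ∫ y, Real.exp (f (rotInv θ y)) * φ y ∂(μ : Measure UnitAddCircle)) :
    IsQuasiInvariant θ f μ := by
  have hfm : Measurable fun y => Real.exp (f (rotInv θ y)) :=
    Real.measurable_exp.comp (hf.comp (continuous_rotInv θ).measurable)
  have hfin : IsFiniteMeasure ((μ : Measure UnitAddCircle).withDensity
      (fun x => ENNReal.ofReal (Real.exp (f (rotInv θ x))))) := by
    refine isFiniteMeasure_withDensity_ofReal (HasFiniteIntegral.of_bounded (C := Real.exp M)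
      (ae_of_all _ fun x => ?_))
    rw [Real.norm_eq_abs, Real.abs_exp]
    exact Real.exp_le_exp.mpr (le_of_abs_le (hM _))
  have hfin' : IsFiniteMeasure ((μ : Measure UnitAddCircle).map (rot θ)) :=
    inferInstance
  refine ext_of_forall_integral_eq_of_IsFiniteMeasure fun φ => ?_
  rw [integral_map (continuous_rot θ).measurable.aemeasurable
    φ.continuous.aestronglyMeasurable, h φ,
    integral_withDensity_eq_integral_toReal_smul hfm.ennreal_ofReal
      (ae_of_all _ fun _ => ENNReal.ofReal_lt_top)]
  refine integral_congr_ae (ae_of_all _ fun y => ?_)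
  simp only [smul_eq_mul]
  rw [ENNReal.toReal_ofReal (Real.exp_pos _).le]

namespace IsVariationBound

variable {f : UnitAddCircle → ℝ} {W : ℝ → ℝ} {V : ℝ}

/-- An atom would force its mass, in the limit, on every open ball around it (portmanteau), but
balls of a fixed small radius carry at most half of that mass. -/
theorem measure_singleton_eq_zero_of_tendsto (h : IsVariationBound f W V) (hf0 : ∫ x, f x = 0)
    {θ : ℝ} (hθ : Irrational θ) {x : ℕ → UnitAddCircle} {N : ℕ → ℕ} (hN : Tendsto N atTop atTop)
    {μ : ProbabilityMeasure UnitAddCircle}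
    (hμ : Tendsto (fun n => orbitProb θ f (N n) (x n)) atTop (𝓝 μ)) (a : UnitAddCircle) :
    (μ : Measure UnitAddCircle) {a} = 0 := by
  by_contra hne
  have hpos : 0 < (μ : Measure UnitAddCircle).real {a} :=
    ENNReal.toReal_pos hne (measure_ne_top _ _)
  obtain ⟨r, hr, N₀, hN₀⟩ := h.exists_radius_orbitMeasure_le hf0 hθ (half_pos hpos)
  have h1 := ProbabilityMeasure.le_liminf_measure_open_of_tendsto hμ
    (Metric.isOpen_ball (x := a) (ε := r))
  have h2 : liminf (fun n => (orbitProb θ f (N n) (x n) : Measure UnitAddCircle)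
      (Metric.ball a r)) atTop ≤ ENNReal.ofReal ((μ : Measure UnitAddCircle).real {a} / 2) := by
    refine liminf_le_of_frequently_le' (Eventually.frequently ?_)
    filter_upwards [hN.eventually_ge_atTop N₀] with n hn
    have := isProbabilityMeasure_orbitMeasure θ f (N n) (x n)
    have h3 := hN₀ (N n) hn (x n) a
    exact ENNReal.le_ofReal_iff_toReal_le (measure_ne_top _ _) (by positivity) |>.mpr h3
  have h4 : (μ : Measure UnitAddCircle) {a} ≤
      ENNReal.ofReal ((μ : Measure UnitAddCircle).real {a} / 2) :=
    (measure_mono (Set.singleton_subset_iff.mpr (Metric.mem_ball_self hr))).trans (h1.trans h2)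
  have h5 := ENNReal.le_ofReal_iff_toReal_le (measure_ne_top _ _) (by positivity) |>.mp h4
  have h6 : (μ : Measure UnitAddCircle).real {a} ≤ (μ : Measure UnitAddCircle).real {a} / 2 := h5
  linarith

theorem ae_continuousAt (h : IsVariationBound f W V) {μ : Measure UnitAddCircle}
    (hμ : ∀ a, μ {a} = 0) : ∀ᵐ x ∂μ, ContinuousAt f x := by
  have : NullSingletonClass μ := ⟨hμ⟩
  exact h.countable_not_continuousAt.measure_zero μ

theorem tendsto_integral (h : IsVariationBound f W V) {μs : ℕ → ProbabilityMeasure UnitAddCircle}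
    {μ : ProbabilityMeasure UnitAddCircle} (hμ : Tendsto μs atTop (𝓝 μ))
    (ha : ∀ a, (μ : Measure UnitAddCircle) {a} = 0) :
    Tendsto (fun n => ∫ x, f x ∂(μs n : Measure UnitAddCircle)) atTop
      (𝓝 (∫ x, f x ∂(μ : Measure UnitAddCircle))) := by
  obtain ⟨M, -, hM⟩ := h.exists_abs_le
  exact tendsto_integral_of_ae_continuousAt hμ h.measurable hM (h.ae_continuousAt ha)

/-- The density is discontinuous only on a countable set, null for the non-atomic limit, so both
sides of the tested equation converge; their difference is two boundary terms of vanishing weight.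
-/
theorem isQuasiInvariant_of_tendsto (h : IsVariationBound f W V) (hf0 : ∫ x, f x = 0)
    {θ : ℝ} (hθ : Irrational θ) {x : ℕ → UnitAddCircle} {N : ℕ → ℕ} (hN : Tendsto N atTop atTop)
    {μ : ProbabilityMeasure UnitAddCircle}
    (hμ : Tendsto (fun n => orbitProb θ f (N n) (x n)) atTop (𝓝 μ)) :
    IsQuasiInvariant θ f μ := by
  have ha := h.measure_singleton_eq_zero_of_tendsto hf0 hθ hN hμ
  have : NullSingletonClass (μ : Measure UnitAddCircle) := ⟨ha⟩
  obtain ⟨M, -, hM⟩ := h.exists_abs_le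
  refine isQuasiInvariant_of_forall_integral_eq h.measurable hM fun φ => ?_
  have hφ : ∀ y, |φ y| ≤ ‖φ‖ := φ.norm_coe_le_norm
  have hexp : ∀ y, |Real.exp (f (rotInv θ y)) * φ y| ≤ Real.exp M * ‖φ‖ := fun y => by
    rw [abs_mul, Real.abs_exp]
    exact mul_le_mul (Real.exp_le_exp.mpr (le_of_abs_le (hM _))) (hφ y) (abs_nonneg _)
      (Real.exp_pos _).le
  have hcont : ∀ᵐ y ∂(μ : Measure UnitAddCircle),
      ContinuousAt (fun y => Real.exp (f (rotInv θ y)) * φ y) y := by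
    have hcount : (rot θ '' {x | ¬ContinuousAt f x}).Countable :=
      h.countable_not_continuousAt.image _
    filter_upwards [hcount.ae_notMem (μ : Measure UnitAddCircle)] with y hy
    have hcf : ContinuousAt f (rotInv θ y) := by
      by_contra hn
      exact hy ⟨_, hn, rot_rotInv θ y⟩
    exact (Real.continuous_exp.continuousAt.comp
      (hcf.comp (continuous_rotInv θ).continuousAt)).mul φ.continuous.continuousAt
  have l1 := tendsto_integral_of_ae_continuousAt hμ (h := fun y => φ (rot θ y))
    (φ.continuous.comp (continuous_rot θ)).measurable (fun y => hφ _)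
    (ae_of_all _ fun y => (φ.continuous.comp (continuous_rot θ)).continuousAt)
  have l2 := tendsto_integral_of_ae_continuousAt hμ
    (h := fun y => Real.exp (f (rotInv θ y)) * φ y)
    ((Real.measurable_exp.comp (h.measurable.comp (continuous_rotInv θ).measurable)).mul
      φ.continuous.measurable) hexp hcont
  have l3 := l1.sub l2
  refine sub_eq_zero.mp (tendsto_nhds_unique l3 ?_)
  rw [Metric.tendsto_atTop]
  intro ε hε
  set A := ‖φ‖ + Real.exp M * ‖φ‖ with hA
  have hA0 : 0 ≤ A := by positivity
  -- A + 1 rather than A makes the final inequality strict and covers A = 0.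
  obtain ⟨N₀, hN₀⟩ := h.exists_forall_weight_le hf0 hθ (ε := ε / (A + 1)) (by positivity)
  obtain ⟨n₀, hn₀⟩ := eventually_atTop.mp (hN.eventually_ge_atTop N₀)
  refine ⟨n₀, fun n hn => ?_⟩
  rw [Real.dist_eq, sub_zero]
  change |∫ y, φ (rot θ y) ∂(orbitMeasure θ f (N n) (x n))
    - ∫ y, Real.exp (f (rotInv θ y)) * φ y ∂(orbitMeasure θ f (N n) (x n))| < ε
  rw [integral_orbitMeasure, integral_orbitMeasure, weightedAvg_comp_rot_sub]
  have b1 := hN₀ (N n) (hn₀ n hn) (x n) (N n) le_rfl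
  have b2 := hN₀ (N n) (hn₀ n hn) (x n) 0 (Nat.zero_le _)
  have p : ∀ k, 0 ≤ 1 / rho θ f k (x n) / wsum θ f (N n) (x n) := fun k =>
    div_nonneg (one_div_pos.mpr (rho_pos ..)).le (wsum_pos ..).le
  calc _ ≤ |φ ((rot θ)^[N n + 1] (x n)) * (1 / rho θ f (N n) (x n) / wsum θ f (N n) (x n))|
        + |Real.exp (f (rotInv θ (x n))) * φ (x n)
          * (1 / rho θ f 0 (x n) / wsum θ f (N n) (x n))| := abs_sub _ _
    _ ≤ ‖φ‖ * (ε / (A + 1)) + Real.exp M * ‖φ‖ * (ε / (A + 1)) := by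
        rw [abs_mul, abs_mul _ (1 / rho θ f 0 (x n) / _), abs_of_nonneg (p _), abs_of_nonneg (p _)]
        gcongr
        · exact p _
        · exact hφ _
        · exact p _
        · exact hexp _
    _ = A * (ε / (A + 1)) := by rw [hA]; ring
    _ < ε := by
        rw [mul_div_assoc', div_lt_iff₀ (by positivity)]
        nlinarith

end IsVariationBound

/-! ### Change of variables for solutions. -/

/-- `IsQuasiInvariant` for arbitrary measures. -/
def IsConformal (θ : ℝ) (f : UnitAddCircle → ℝ) (μ : Measure UnitAddCircle) : Prop :=
  μ.map (rot θ) = μ.withDensity (fun x => ENNReal.ofReal (Real.exp (f (rotInv θ x))))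

/-- Testing the equation on (φ e^{−f}) ∘ T⁻¹ cancels the density. -/
theorem IsConformal.lintegral_rotInv {θ : ℝ} {f : UnitAddCircle → ℝ} {μ : Measure UnitAddCircle}
    (hμ : IsConformal θ f μ) (hf : Measurable f) {φ : UnitAddCircle → ENNReal}
    (hφ : Measurable φ) :
    ∫⁻ y, φ (rotInv θ y) ∂μ = ∫⁻ y, φ y * ENNReal.ofReal (Real.exp (-f y)) ∂μ := by
  have hR := (continuous_rotInv θ).measurable
  have hψ : Measurable fun y => φ (rotInv θ y) * ENNReal.ofReal (Real.exp (-f (rotInv θ y))) :=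
    (hφ.comp hR).mul (Real.measurable_exp.comp (hf.comp hR).neg).ennreal_ofReal
  have h1 : ∫⁻ y, φ y * ENNReal.ofReal (Real.exp (-f y)) ∂μ
      = ∫⁻ y, φ (rotInv θ y) * ENNReal.ofReal (Real.exp (-f (rotInv θ y))) ∂(μ.map (rot θ)) := by
    rw [lintegral_map hψ (continuous_rot θ).measurable]
    simp only [rotInv_rot]
  have hw : Measurable fun y => ENNReal.ofReal (Real.exp (f (rotInv θ y))) :=
    (Real.measurable_exp.comp (hf.comp hR)).ennreal_ofReal
  rw [h1, hμ, lintegral_withDensity_eq_lintegral_mul _ hw hψ]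
  refine lintegral_congr fun y => ?_
  simp only [Pi.mul_apply]
  rw [mul_comm, mul_assoc, ← ENNReal.ofReal_mul (Real.exp_pos _).le, ← Real.exp_add]
  simp

theorem measurable_rho (θ : ℝ) {f : UnitAddCircle → ℝ} (hf : Measurable f) (n : ℕ) :
    Measurable (rho θ f n) := by
  unfold rho birkhoffSum
  refine Real.measurable_exp.comp (Finset.measurable_fun_sum _ fun k _ => ?_)
  exact hf.comp ((continuous_rot θ).measurable.iterate k)

theorem rho_succ' (θ : ℝ) (f : UnitAddCircle → ℝ) (n : ℕ) (x : UnitAddCircle) :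
    rho θ f (n + 1) x = Real.exp (f x) * rho θ f n (rot θ x) := by
  rw [add_comm, rho_add]; simp [rho]

theorem IsConformal.lintegral_rotInv_iterate {θ : ℝ} {f : UnitAddCircle → ℝ}
    {μ : Measure UnitAddCircle} (hμ : IsConformal θ f μ) (hf : Measurable f) (j : ℕ)
    {φ : UnitAddCircle → ENNReal} (hφ : Measurable φ) :
    ∫⁻ y, φ ((rotInv θ)^[j] y) ∂μ = ∫⁻ y, φ y * ENNReal.ofReal (1 / rho θ f j y) ∂μ := by
  induction j generalizing φ with
  | zero => simp [rho]
  | succ j ih =>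
    have hR := (continuous_rotInv θ).measurable
    have hρ : Measurable fun y => ENNReal.ofReal (1 / rho θ f j (rot θ y)) := by
      have := (measurable_rho θ hf j).comp (continuous_rot θ).measurable
      exact (measurable_const.div this).ennreal_ofReal
    simp only [Function.iterate_succ_apply']
    rw [ih (φ := fun y => φ (rotInv θ y)) (hφ.comp hR)]
    have h1 := hμ.lintegral_rotInv hf (hφ.mul hρ)
    simp only [Pi.mul_apply, rot_rotInv] at h1
    rw [h1]
    refine lintegral_congr fun y => ?_
    rw [mul_assoc, ← ENNReal.ofReal_mul (one_div_pos.mpr (rho_pos ..)).le, rho_succ', Real.exp_neg]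
    congr 2
    rw [one_div, one_div, mul_inv, mul_comm]

/-! ### Covering by rotated arcs. -/

/-- The arc of length `3 / q` around the origin. -/
def arc (q : ℕ) : Set UnitAddCircle :=
  (fun t : ℝ => (t : UnitAddCircle)) '' Set.Icc (-1 / q) (2 / q)

/-- The image of `arc q` under the `j`-th iterate of the rotation. -/
def arcShift (θ : ℝ) (q j : ℕ) : Set UnitAddCircle := (rotInv θ)^[j] ⁻¹' arc q

theorem measurableSet_arc (q : ℕ) : MeasurableSet (arc q) :=
  (isCompact_Icc.image (AddCircle.continuous_mk' 1)).measurableSet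

theorem measurableSet_arcShift (θ : ℝ) (q j : ℕ) : MeasurableSet (arcShift θ q j) :=
  ((continuous_rotInv θ).measurable.iterate j) (measurableSet_arc q)

theorem rotInv_iterate (θ : ℝ) (k : ℕ) (x : UnitAddCircle) :
    (rotInv θ)^[k] x = x - ((k * θ : ℝ) : UnitAddCircle) := by
  induction k with
  | zero => simp
  | succ k ih =>
    rw [Function.iterate_succ_apply', ih, rotInv, sub_sub, ← AddCircle.coe_add]
    push_cast; congr 2; ring

theorem exists_eq_add_intCast {s t : ℝ} (h : (s : UnitAddCircle) = t) : ∃ m : ℤ, s = t + m := by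
  have h0 : ((s - t : ℝ) : UnitAddCircle) = 0 := by rw [AddCircle.coe_sub, h, sub_self]
  obtain ⟨m, hm⟩ := (AddCircle.coe_eq_zero_iff (1 : ℝ)).mp h0
  exact ⟨m, by simp at hm; linarith⟩

theorem coe_mem_arcShift_iff (θ : ℝ) (q j : ℕ) (t : ℝ) :
    (t : UnitAddCircle) ∈ arcShift θ q j ↔
      ∃ m : ℤ, t + m - j * θ ∈ Set.Icc (-1 / (q : ℝ)) (2 / q) := by
  rw [arcShift, Set.mem_preimage, rotInv_iterate, ← AddCircle.coe_sub, arc]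
  constructor
  · rintro ⟨s, hs, hst⟩
    obtain ⟨m, rfl⟩ := exists_eq_add_intCast hst
    exact ⟨m, by convert hs using 1; ring⟩
  · rintro ⟨m, hm⟩
    refine ⟨_, hm, ?_⟩
    simp only
    rw [← coe_add_intCast (t - j * θ) m]
    congr 1; ring

theorem dist_le_of_mem_arcShift {θ : ℝ} {q j : ℕ} {x y : UnitAddCircle}
    (hx : x ∈ arcShift θ q j) (hy : y ∈ arcShift θ q j) : dist x y ≤ 3 / q := by
  obtain ⟨s, hs, hsx⟩ := hx
  obtain ⟨t, ht, hty⟩ := hy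
  rw [rotInv_iterate] at hsx hty
  have h1 : x - y = ((s - t : ℝ) : UnitAddCircle) := by
    rw [AddCircle.coe_sub]; simp only at hsx hty; rw [hsx, hty]; abel
  rw [dist_eq_norm, h1]
  refine (QuotientAddGroup.norm_mk_le_norm (m := s - t)).trans ?_
  rw [Real.norm_eq_abs, abs_le]
  have e1 := hs.1
  have e2 := hs.2
  have e3 := ht.1
  have e4 := ht.2
  rw [neg_div] at e1 e3
  have : (3 : ℝ) / q = 2 / q + 1 / q := by ring
  constructor <;> linarith

namespace IsDirichletApprox

variable {θ : ℝ} {p : ℤ} {q : ℕ}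

/-- With m = ⌊qt⌋ and Bézout's ap + bq = 1, the residue j of ma satisfies jp ≡ m mod q, so modulo 1
the point t exceeds jp/q by at most 1/q. Replacing jp/q by jθ costs a further 1/q on either side,
which is why the arc is [−1/q, 2/q]. -/
theorem exists_mem_arcShift (h : IsDirichletApprox θ p q) (x : UnitAddCircle) :
    ∃ j < q, x ∈ arcShift θ q j := by
  obtain ⟨t, rfl⟩ := QuotientAddGroup.mk_surjective x
  have hq : (0 : ℝ) < q := by exact_mod_cast h.pos
  have hqz : (0 : ℤ) < q := by exact_mod_cast h.pos
  obtain ⟨a, b, hab⟩ := h.isCoprime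
  set m := ⌊q * t⌋ with hm
  have h0 := Int.emod_nonneg (m * a) hqz.ne'
  have h1 := Int.emod_lt_of_pos (m * a) hqz
  obtain ⟨j, hj⟩ := Int.eq_ofNat_of_zero_le h0
  have hjq : j < q := by omega
  obtain ⟨k, hk⟩ : ∃ k : ℤ, m + q * k = j * p := by
    refine ⟨-(m * a / q) * p - m * b, ?_⟩
    have h2 := Int.emod_add_mul_ediv (m * a) q
    rw [hj] at h2
    have h3 : (j : ℤ) = m * a - q * (m * a / q) := by linarith
    rw [h3]
    linear_combination -m * hab
  refine ⟨j, hjq, (coe_mem_arcShift_iff θ q j t).mpr ⟨k, ?_⟩⟩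
  have h4 := abs_le.mp (h.abs_mul_sub_le hjq.le)
  have h5 : (m : ℝ) ≤ q * t := Int.floor_le _
  have h6 : q * t < m + 1 := Int.lt_floor_add_one _
  have h7 : (m : ℝ) + q * k = j * p := by exact_mod_cast hk
  have h8 : t + k - j * p / q = (q * t - m) / q := by
    rw [← h7]; field_simp; ring
  have h9 : 0 ≤ (q * t - m) / q := div_nonneg (by linarith) hq.le
  have h10 : (q * t - m) / q ≤ 1 / q := by gcongr; linarith
  rw [neg_div, show (2 : ℝ) / q = 1 / q + 1 / q by ring]
  constructor <;> linarith

/-- Each such j yields an integer jp − qk in an interval of length 5, and distinct j < q yield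
distinct integers because p is prime to q. -/
theorem card_filter_mem_arcShift_le (h : IsDirichletApprox θ p q) (x : UnitAddCircle)
    [DecidablePred fun j => x ∈ arcShift θ q j] :
    ((Finset.range q).filter fun j => x ∈ arcShift θ q j).card ≤ 6 := by
  obtain ⟨t, rfl⟩ := QuotientAddGroup.mk_surjective x
  have hq : (0 : ℝ) < q := by exact_mod_cast h.pos
  -- Stated for all j, with k = 0 where the conditions fail, so that k can be chosen as a total
  -- function.
  have key : ∀ j : ℕ, ∃ k : ℤ, j < q → (t : UnitAddCircle) ∈ arcShift θ q j →
      (j * p - q * k) ∈ Finset.Icc ⌈q * t - 3⌉ ⌊q * t + 2⌋ := by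
    intro j
    by_cases hj : j < q ∧ (t : UnitAddCircle) ∈ arcShift θ q j
    · obtain ⟨k, hk⟩ := (coe_mem_arcShift_iff θ q j t).mp hj.2
      refine ⟨k, fun _ _ => ?_⟩
      have h4 := abs_le.mp (h.abs_mul_sub_le hj.1.le)
      have h1 := hk.1
      have h2 := hk.2
      rw [neg_div] at h1
      have e1 : t + k - j * p / q ≤ 3 / q := by
        rw [show (3 : ℝ) / q = 2 / q + 1 / q by ring]; linarith
      have e2 : -2 / q ≤ t + k - j * p / q := by
        rw [show -(2 : ℝ) / q = -(1 / q) - 1 / q by ring]; linarith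
      have e3 : (t + k - j * p / q) * q = q * t - (j * p - q * k) := by field_simp; ring
      rw [le_div_iff₀ hq, e3] at e1
      rw [div_le_iff₀ hq, e3] at e2
      rw [Finset.mem_Icc, Int.ceil_le, Int.le_floor]
      push_cast
      constructor <;> linarith
    · exact ⟨0, fun h1 h2 => absurd ⟨h1, h2⟩ hj⟩
  choose k hk using key
  have hcard : (Finset.Icc ⌈q * t - 3⌉ ⌊q * t + 2⌋).card ≤ 6 := by
    rw [Int.card_Icc]
    have h1 : (⌊q * t + 2⌋ : ℝ) ≤ q * t + 2 := Int.floor_le _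
    have h2 : q * t - 3 ≤ ⌈q * t - 3⌉ := Int.le_ceil _
    have h3 : (⌊q * t + 2⌋ : ℝ) ≤ ⌈q * t - 3⌉ + 5 := by linarith
    have h4 : ⌊q * t + 2⌋ ≤ ⌈q * t - 3⌉ + 5 := by exact_mod_cast h3
    omega
  refine le_trans (Finset.card_le_card_of_injOn (fun j : ℕ => (j : ℤ) * p - q * k j) ?_ ?_) hcard
  · intro j hj
    have hj' := Finset.mem_filter.mp hj
    exact hk j (Finset.mem_range.mp hj'.1) hj'.2
  · intro i hi j hj hij
    have hi' := Finset.mem_range.mp (Finset.mem_filter.mp hi).1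
    have hj' := Finset.mem_range.mp (Finset.mem_filter.mp hj).1
    have h4 : (q : ℤ) ∣ ((i : ℤ) - j) * p := ⟨k i - k j, by simp only at hij; linarith⟩
    have h5 : (q : ℤ) ∣ (i : ℤ) - j := h.isCoprime.symm.dvd_of_dvd_mul_right h4
    have h6 := Int.eq_zero_of_abs_lt_dvd h5 (by rw [abs_lt]; omega)
    omega

theorem measure_le_sum_arcShift (h : IsDirichletApprox θ p q) (μ : Measure UnitAddCircle)
    (K : Set UnitAddCircle) [DecidablePred fun j => (arcShift θ q j ∩ K).Nonempty] :
    μ K ≤ ∑ j ∈ (Finset.range q).filter (fun j => (arcShift θ q j ∩ K).Nonempty),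
      μ (arcShift θ q j) := by
  refine le_trans (measure_mono fun x hx => ?_) (measure_biUnion_finset_le _ _)
  obtain ⟨j, hj, hxj⟩ := h.exists_mem_arcShift x
  simp only [Set.mem_iUnion, Finset.mem_filter, Finset.mem_range]
  exact ⟨j, ⟨hj, x, hxj, hx⟩, hxj⟩

theorem sum_arcShift_le (h : IsDirichletApprox θ p q) (μ : Measure UnitAddCircle)
    {S : Finset ℕ} (hS : S ⊆ Finset.range q) {U : Set UnitAddCircle}
    (hSU : ∀ j ∈ S, arcShift θ q j ⊆ U) (hU : MeasurableSet U) :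
    ∑ j ∈ S, μ (arcShift θ q j) ≤ 6 * μ U := by
  classical
  calc ∑ j ∈ S, μ (arcShift θ q j)
      = ∫⁻ x, ∑ j ∈ S, (arcShift θ q j).indicator 1 x ∂μ := by
        rw [lintegral_finsetSum _ fun j _ =>
          measurable_one.indicator (measurableSet_arcShift θ q j)]
        exact Finset.sum_congr rfl fun j _ =>
          (lintegral_indicator_one (measurableSet_arcShift θ q j)).symm
    _ ≤ ∫⁻ x, 6 * U.indicator 1 x ∂μ := by
        refine lintegral_mono fun x => ?_
        by_cases hx : x ∈ U
        · simp only [Set.indicator_of_mem hx, Pi.one_apply, mul_one]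
          calc ∑ j ∈ S, (arcShift θ q j).indicator (1 : UnitAddCircle → ENNReal) x
              ≤ ∑ j ∈ Finset.range q, (arcShift θ q j).indicator 1 x :=
                Finset.sum_le_sum_of_subset hS
            _ = (((Finset.range q).filter fun j => x ∈ arcShift θ q j).card : ENNReal) := by
                simp [Set.indicator_apply]
            _ ≤ 6 := by exact_mod_cast h.card_filter_mem_arcShift_le x
        · have : ∀ j ∈ S, (arcShift θ q j).indicator (1 : UnitAddCircle → ENNReal) x = 0 :=
            fun j hj => Set.indicator_of_notMem (fun hxj => hx (hSU j hj hxj)) _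
          rw [Finset.sum_eq_zero this]
          exact zero_le
    _ = 6 * μ U := by
        rw [lintegral_const_mul _ (measurable_one.indicator hU), lintegral_indicator_one hU]

end IsDirichletApprox

/-! ### Bounded distortion and comparability of solutions. -/

theorem IsConformal.measure_arcShift {θ : ℝ} {f : UnitAddCircle → ℝ} {μ : Measure UnitAddCircle}
    (hμ : IsConformal θ f μ) (hf : Measurable f) (q j : ℕ) :
    μ (arcShift θ q j) = ∫⁻ y in arc q, ENNReal.ofReal (1 / rho θ f j y) ∂μ := by
  have h1 := hμ.lintegral_rotInv_iterate hf j (measurable_one.indicator (measurableSet_arc q))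
  rw [← lintegral_indicator_one (measurableSet_arcShift θ q j),
    ← lintegral_indicator (measurableSet_arc q)]
  refine h1.trans (lintegral_congr fun y => ?_)
  by_cases hy : y ∈ arc q <;> simp [hy]

namespace IsVariationBound

variable {f : UnitAddCircle → ℝ} {W : ℝ → ℝ} {V : ℝ}

/-- At each time i < q both orbits lie in the same window of width 5/q, so the window estimate
applies without any condition on the mean of f. -/
theorem abs_birkhoffSum_sub_le (h : IsVariationBound f W V) {θ : ℝ} {p : ℤ} {q : ℕ}
    (hpq : IsDirichletApprox θ p q) {j : ℕ} (hj : j ≤ q) {x y : UnitAddCircle} (hx : x ∈ arc q)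
    (hy : y ∈ arc q) : |birkhoffSum (rot θ) f j x - birkhoffSum (rot θ) f j y| ≤ 5 * V := by
  obtain ⟨s, hs, rfl⟩ := hx
  obtain ⟨t, ht, rfl⟩ := hy
  have hmem : ∀ u ∈ Set.Icc (-1 / (q : ℝ)) (2 / q), ∀ i < q,
      u + i * θ ∈ Set.Icc ((0 : ℝ) + (i * p - 2) / q) (0 + (i * p + 3) / q) := by
    intro u hu i hi
    have h4 := abs_le.mp (hpq.abs_mul_sub_le hi.le)
    have h1 := hu.1
    have h2 := hu.2
    rw [neg_div] at h1
    rw [show (2 : ℝ) / q = 1 / q + 1 / q by ring] at h2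
    rw [sub_div, add_div, show (2 : ℝ) / q = 1 / q + 1 / q by ring,
      show (3 : ℝ) / q = 1 / q + 1 / q + 1 / q by ring]
    constructor <;> linarith
  have key := h.sum_abs_sub_le hpq.pos hpq.isCoprime 0 (a := fun i => s + i * θ)
    (b := fun i => t + i * θ) (fun i hi => hmem s hs i hi) (fun i hi => hmem t ht i hi)
  rw [birkhoffSum, birkhoffSum, ← Finset.sum_sub_distrib]
  refine (Finset.abs_sum_le_sum_abs _ _).trans (le_trans ?_ key)
  refine (Finset.sum_le_sum_of_subset_of_nonneg (Finset.range_mono hj)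
    fun _ _ _ => abs_nonneg _).trans (le_of_eq (Finset.sum_congr rfl fun i _ => ?_))
  rw [rot_iterate, rot_iterate, ← AddCircle.coe_add, ← AddCircle.coe_add]

/-- The mass of a rotate is the integral of 1/ρ_j over the base arc; bounded distortion replaces the
integrand by its value at 0. -/
theorem measure_arcShift_comparable (h : IsVariationBound f W V) {θ : ℝ} {p : ℤ} {q : ℕ}
    (hpq : IsDirichletApprox θ p q) {μ : Measure UnitAddCircle} (hμ : IsConformal θ f μ)
    {j : ℕ} (hj : j ≤ q) :
    μ (arcShift θ q j) ≤
        ENNReal.ofReal (Real.exp (5 * V)) * (ENNReal.ofReal (1 / rho θ f j 0) * μ (arc q)) ∧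
      ENNReal.ofReal (1 / rho θ f j 0) * μ (arc q) ≤
        ENNReal.ofReal (Real.exp (5 * V)) * μ (arcShift θ q j) := by
  have hρm : Measurable fun y => ENNReal.ofReal (1 / rho θ f j y) :=
    (measurable_const.div (measurable_rho θ h.measurable j)).ennreal_ofReal
  have h0 : (0 : UnitAddCircle) ∈ arc q := by
    refine ⟨0, ⟨?_, by positivity⟩, rfl⟩
    rw [neg_div, neg_nonpos]; positivity
  have hle : ∀ x ∈ arc q, ∀ y ∈ arc q, ENNReal.ofReal (1 / rho θ f j x) ≤
      ENNReal.ofReal (Real.exp (5 * V)) * ENNReal.ofReal (1 / rho θ f j y) := by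
    intro x hx y hy
    rw [← ENNReal.ofReal_mul (Real.exp_pos _).le]
    refine ENNReal.ofReal_le_ofReal ?_
    simp only [rho, one_div, ← Real.exp_neg, ← Real.exp_add]
    have := abs_le.mp (h.abs_birkhoffSum_sub_le hpq hj hx hy)
    exact Real.exp_le_exp.mpr (by linarith)
  rw [hμ.measure_arcShift h.measurable]
  constructor
  · rw [← mul_assoc, ← setLIntegral_const]
    exact setLIntegral_mono' (measurableSet_arc q) fun y hy => hle y hy 0 h0
  · rw [← setLIntegral_const, ← lintegral_const_mul _ hρm]
    exact setLIntegral_mono' (measurableSet_arc q) fun y hy => hle 0 h0 y hy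

/-- Up to bounded factors, both measures give the rotates the same weights 1/ρ_i(0) times the mass
of the base arc, which cancels in the ratio of one rotate to the total. The product form also admits
null measures. -/
theorem measure_arcShift_mul_le (h : IsVariationBound f W V) {θ : ℝ} {p : ℤ} {q : ℕ}
    (hpq : IsDirichletApprox θ p q) {μ ν : Measure UnitAddCircle} (hμ : IsConformal θ f μ)
    (hν : IsConformal θ f ν) {j : ℕ} (hj : j < q) :
    μ (arcShift θ q j) * ν Set.univ ≤
      6 * ENNReal.ofReal (Real.exp (5 * V)) ^ 4 * (ν (arcShift θ q j) * μ Set.univ) := by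
  classical
  set E := ENNReal.ofReal (Real.exp (5 * V)) with hE
  set a : ℕ → ENNReal := fun i => ENNReal.ofReal (1 / rho θ f i 0) with ha
  set A := ∑ i ∈ Finset.range q, a i with hA
  have hν1 : ν Set.univ ≤ E * (A * ν (arc q)) := by
    calc ν Set.univ ≤ ∑ i ∈ Finset.range q, ν (arcShift θ q i) :=
          (hpq.measure_le_sum_arcShift ν Set.univ).trans
            (Finset.sum_le_sum_of_subset (Finset.filter_subset _ _))
      _ ≤ ∑ i ∈ Finset.range q, E * (a i * ν (arc q)) := Finset.sum_le_sum fun i hi =>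
          (h.measure_arcShift_comparable hpq hν (Finset.mem_range.mp hi).le).1
      _ = E * (A * ν (arc q)) := by rw [← Finset.mul_sum, ← Finset.sum_mul]
  have hμ1 : A * μ (arc q) ≤ E * (6 * μ Set.univ) := by
    calc A * μ (arc q) = ∑ i ∈ Finset.range q, a i * μ (arc q) := by rw [Finset.sum_mul]
      _ ≤ ∑ i ∈ Finset.range q, E * μ (arcShift θ q i) := Finset.sum_le_sum fun i hi =>
          (h.measure_arcShift_comparable hpq hμ (Finset.mem_range.mp hi).le).2
      _ ≤ E * (6 * μ Set.univ) := by
          rw [← Finset.mul_sum]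
          gcongr
          exact hpq.sum_arcShift_le μ subset_rfl (fun _ _ => Set.subset_univ _) MeasurableSet.univ
  calc μ (arcShift θ q j) * ν Set.univ
      ≤ E * (a j * μ (arc q)) * (E * (A * ν (arc q))) :=
        mul_le_mul' (h.measure_arcShift_comparable hpq hμ hj.le).1 hν1
    _ = E ^ 2 * (a j * ν (arc q)) * (A * μ (arc q)) := by ring
    _ ≤ E ^ 2 * (E * ν (arcShift θ q j)) * (E * (6 * μ Set.univ)) :=
        mul_le_mul' (mul_le_mul' le_rfl (h.measure_arcShift_comparable hpq hν hj.le).2) hμ1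
    _ = 6 * E ^ 4 * (ν (arcShift θ q j) * μ Set.univ) := by ring

/-- Two finite solutions of the quasi-invariance equation are comparable. -/
theorem measure_mul_le (h : IsVariationBound f W V) {θ : ℝ} (hθ : Irrational θ)
    {μ ν : Measure UnitAddCircle} [IsFiniteMeasure μ] [IsFiniteMeasure ν]
    (hμ : IsConformal θ f μ) (hν : IsConformal θ f ν) {B : Set UnitAddCircle}
    (hB : MeasurableSet B) :
    μ B * ν Set.univ ≤
      36 * ENNReal.ofReal (Real.exp (5 * V)) ^ 4 * (ν B * μ Set.univ) := by
  classical
  set E := ENNReal.ofReal (Real.exp (5 * V)) with hE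
  -- Once 3/q < δ, the rotates meeting K cover it and stay in its δ-thickening; the multiplicity
  -- bound there gives the second factor 6. Letting δ → 0 treats closed sets, and inner regularity
  -- the rest.
  have hthick : ∀ (K : Set UnitAddCircle) (δ : ℝ), 0 < δ →
      μ K * ν Set.univ ≤ 36 * E ^ 4 * (ν (Metric.thickening δ K) * μ Set.univ) := by
    intro K δ hδ
    obtain ⟨q, ⟨p, hpq⟩, hq⟩ := (infinite_isDirichletApprox hθ).exists_gt ⌈3 / δ⌉₊
    have hqδ : 3 / (q : ℝ) < δ := by
      have h1 : 3 / δ < q := lt_of_le_of_lt (Nat.le_ceil _) (by exact_mod_cast hq)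
      have hq0 : (0 : ℝ) < q := by exact_mod_cast hpq.pos
      rw [div_lt_iff₀ hδ] at h1
      rw [div_lt_iff₀ hq0]; linarith
    set S := (Finset.range q).filter (fun j => (arcShift θ q j ∩ K).Nonempty) with hS
    have hSU : ∀ j ∈ S, arcShift θ q j ⊆ Metric.thickening δ K := by
      intro j hj x hx
      obtain ⟨y, hy, hyK⟩ := (Finset.mem_filter.mp hj).2
      exact Metric.mem_thickening_iff.mpr ⟨y, hyK, (dist_le_of_mem_arcShift hx hy).trans_lt hqδ⟩
    calc μ K * ν Set.univ ≤ (∑ j ∈ S, μ (arcShift θ q j)) * ν Set.univ := by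
          gcongr; exact hpq.measure_le_sum_arcShift μ K
      _ = ∑ j ∈ S, μ (arcShift θ q j) * ν Set.univ := Finset.sum_mul ..
      _ ≤ ∑ j ∈ S, 6 * E ^ 4 * (ν (arcShift θ q j) * μ Set.univ) := Finset.sum_le_sum fun j hj =>
          h.measure_arcShift_mul_le hpq hμ hν (Finset.mem_range.mp (Finset.mem_filter.mp hj).1)
      _ = 6 * E ^ 4 * ((∑ j ∈ S, ν (arcShift θ q j)) * μ Set.univ) := by
          rw [← Finset.mul_sum, Finset.sum_mul]
      _ ≤ 6 * E ^ 4 * ((6 * ν (Metric.thickening δ K)) * μ Set.univ) := by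
          gcongr
          exact hpq.sum_arcShift_le ν (Finset.filter_subset _ _) hSU
            Metric.isOpen_thickening.measurableSet
      _ = 36 * E ^ 4 * (ν (Metric.thickening δ K) * μ Set.univ) := by ring
  have hC : 36 * E ^ 4 ≠ ⊤ :=
    ENNReal.mul_ne_top (by simp) (ENNReal.pow_ne_top ENNReal.ofReal_ne_top)
  have hclosed : ∀ K : Set UnitAddCircle, IsClosed K →
      μ K * ν Set.univ ≤ 36 * E ^ 4 * (ν K * μ Set.univ) := by
    intro K hK
    have h1 := tendsto_measure_thickening_of_isClosed (μ := ν) ⟨1, one_pos, measure_ne_top _ _⟩ hK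
    have h2 := ENNReal.Tendsto.const_mul (a := 36 * E ^ 4)
      (ENNReal.Tendsto.mul_const (b := μ Set.univ) h1 (Or.inr (measure_ne_top _ _))) (Or.inr hC)
    exact ge_of_tendsto h2 (by filter_upwards [self_mem_nhdsWithin] with δ hδ using hthick K δ hδ)
  rw [hB.measure_eq_iSup_isClosed_of_ne_top (measure_ne_top μ B)]
  simp only [ENNReal.iSup_mul]
  refine iSup_le fun K => iSup_le fun hKB => iSup_le fun hK => (hclosed K hK).trans ?_
  gcongr

end IsVariationBound

/-! ### Uniqueness of the solution. -/

/-- The equation is linear in the measure: adding back tν on both sides recovers the one for μ, and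
the added term is finite, so it cancels. -/
theorem IsConformal.sub_smul {θ : ℝ} {f : UnitAddCircle → ℝ} (hf : Measurable f)
    {μ ν : Measure UnitAddCircle} [IsFiniteMeasure μ] [IsFiniteMeasure ν]
    (hμ : IsConformal θ f μ) (hν : IsConformal θ f ν) {t : ENNReal} (ht : t ≠ ⊤)
    (hle : t • ν ≤ μ) : IsConformal θ f (μ - t • ν) := by
  have hrot := (continuous_rot θ).measurable
  have hfin : IsFiniteMeasure (t • ν) := ν.smul_finite ht
  set w : UnitAddCircle → ENNReal := fun x => ENNReal.ofReal (Real.exp (f (rotInv θ x))) with hw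
  have hwm : Measurable w :=
    (Real.measurable_exp.comp (hf.comp (continuous_rotInv θ).measurable)).ennreal_ofReal
  have hadd : μ - t • ν + t • ν = μ := Measure.sub_add_cancel_of_le hle
  have h1 : (μ - t • ν).map (rot θ) + t • ν.map (rot θ)
      = (μ - t • ν).withDensity w + t • ν.map (rot θ) := by
    conv_rhs => rw [show ν.map (rot θ) = ν.withDensity w from hν]
    rw [← Measure.map_smul, ← Measure.map_add _ _ hrot, hadd, ← withDensity_smul_measure,
      ← withDensity_add_measure, hadd]
    exact hμ
  refine Measure.ext fun B hB => ?_
  have h2 := congrArg (fun m : Measure UnitAddCircle => m B) h1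
  simp only [Measure.add_apply] at h2
  refine (ENNReal.add_left_inj ?_).mp h2
  have : IsFiniteMeasure (t • ν.map (rot θ)) := (ν.map (rot θ)).smul_finite ht
  exact measure_ne_top _ _

/-- The quasi-invariance equation has at most one solution among probability measures. -/
theorem IsVariationBound.eq_of_isQuasiInvariant {f : UnitAddCircle → ℝ} {W : ℝ → ℝ} {V : ℝ}
    (h : IsVariationBound f W V) {θ : ℝ} (hθ : Irrational θ)
    {μ ν : ProbabilityMeasure UnitAddCircle} (hμ : IsQuasiInvariant θ f μ)
    (hν : IsQuasiInvariant θ f ν) : μ = ν := by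
  set C : ℝ := 36 * Real.exp (5 * V) ^ 4 with hC
  have hC1 : 1 ≤ C := by
    have h1 : 1 ≤ Real.exp (5 * V) := Real.one_le_exp (by linarith [h.nonneg])
    have : 1 ≤ Real.exp (5 * V) ^ 4 := one_le_pow₀ h1
    linarith
  have hC0 : 0 < C := by linarith
  have hCE : (36 * ENNReal.ofReal (Real.exp (5 * V)) ^ 4) = ENNReal.ofReal C := by
    rw [hC, ENNReal.ofReal_mul (by norm_num), ENNReal.ofReal_pow (Real.exp_pos _).le]
    simp
  set c : ℝ := 1 - 1 / C with hc
  have hc0 : 0 ≤ c := by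
    have : 1 / C ≤ 1 := by rw [div_le_one hC0]; exact hC1
    linarith
  have hc1 : c < 1 := by
    have : 0 < 1 / C := by positivity
    linarith
  -- From μ ≥ tν, comparability of ν with the residual μ − tν, of mass 1 − t, gives μ ≥ (t + (1 −
  -- t)/C)ν. Started at t = 0, this recursion is t = 1 − cⁿ with c = 1 − 1/C.
  have key : ∀ n : ℕ, ∀ B, MeasurableSet B →
      (1 - c ^ n) * (ν : Measure UnitAddCircle).real B ≤ (μ : Measure UnitAddCircle).real B := by
    intro n
    induction n with
    | zero => intro B _; simp
    | succ n ih =>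
      intro B hB
      set t : ℝ := 1 - c ^ n with ht
      have ht0 : 0 ≤ t := by
        have : c ^ n ≤ 1 := pow_le_one₀ hc0 hc1.le
        linarith
      have hle : ENNReal.ofReal t • (ν : Measure UnitAddCircle) ≤ μ := by
        refine Measure.le_iff.mpr fun B hB => ?_
        have h1 := ih B hB
        rw [Measure.smul_apply, smul_eq_mul,
          ← ofReal_measureReal (μ := (ν : Measure UnitAddCircle)),
          ← ofReal_measureReal (μ := (μ : Measure UnitAddCircle)), ← ENNReal.ofReal_mul ht0]
        exact ENNReal.ofReal_le_ofReal h1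
      have hfin : IsFiniteMeasure (ENNReal.ofReal t • (ν : Measure UnitAddCircle)) :=
        (ν : Measure UnitAddCircle).smul_finite ENNReal.ofReal_ne_top
      set m := (μ : Measure UnitAddCircle) - ENNReal.ofReal t • (ν : Measure UnitAddCircle) with hm
      have hmc : IsConformal θ f m :=
        IsConformal.sub_smul h.measurable hμ hν ENNReal.ofReal_ne_top hle
      have hmB : ∀ B, m.real B = (μ : Measure UnitAddCircle).real B
          - t * (ν : Measure UnitAddCircle).real B := by
        intro B
        have h1 : m + ENNReal.ofReal t • (ν : Measure UnitAddCircle) = μ :=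
          Measure.sub_add_cancel_of_le hle
        have h2 : (m + ENNReal.ofReal t • (ν : Measure UnitAddCircle)).real B
            = (μ : Measure UnitAddCircle).real B := by rw [h1]
        rw [measureReal_add_apply, measureReal_ennreal_smul_apply,
          ENNReal.toReal_ofReal ht0] at h2
        linarith
      have h3 := h.measure_mul_le hθ (μ := (ν : Measure UnitAddCircle)) (ν := m) hν hmc hB
      rw [hCE, measure_univ (μ := (ν : Measure UnitAddCircle)), mul_one] at h3
      have h4 : (ν : Measure UnitAddCircle).real B * m.real Set.univ ≤ C * m.real B := by
        have := ENNReal.toReal_mono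
          (ENNReal.mul_ne_top ENNReal.ofReal_ne_top (measure_ne_top _ _)) h3
        rwa [ENNReal.toReal_mul, ENNReal.toReal_mul, ENNReal.toReal_ofReal hC0.le] at this
      rw [hmB, hmB, probReal_univ, probReal_univ] at h4
      have h5 : (ν : Measure UnitAddCircle).real B * (1 - t * 1) * (1 / C) ≤
          (μ : Measure UnitAddCircle).real B - t * (ν : Measure UnitAddCircle).real B := by
        rw [mul_one_div, div_le_iff₀ hC0]; linarith
      have h6 : 1 / C = 1 - c := by rw [hc]; ring
      rw [h6, ht] at h5
      rw [pow_succ]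
      linarith
  have hlim : ∀ B, MeasurableSet B →
      (ν : Measure UnitAddCircle).real B ≤ (μ : Measure UnitAddCircle).real B := by
    intro B hB
    have h1 : Tendsto (fun n : ℕ => (1 - c ^ n) * (ν : Measure UnitAddCircle).real B) atTop
        (𝓝 ((1 - 0) * (ν : Measure UnitAddCircle).real B)) :=
      ((tendsto_pow_atTop_nhds_zero_of_lt_one hc0 hc1).const_sub 1).mul_const _
    rw [sub_zero, one_mul] at h1
    exact le_of_tendsto' h1 fun n => key n B hB
  have heq : (μ : Measure UnitAddCircle) = ν := by
    refine Measure.ext fun B hB => ?_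
    -- Since both masses are one, the inequality on the complement reverses the one on B.
    have h1 := hlim B hB
    have h2 := hlim Bᶜ hB.compl
    rw [probReal_compl_eq_one_sub hB, probReal_compl_eq_one_sub hB] at h2
    exact (measureReal_eq_measureReal_iff (measure_ne_top _ _) (measure_ne_top _ _)).mp
      (le_antisymm (by linarith) h1)
  exact Subtype.ext heq

/-! ### Compactness and conclusion. -/

theorem exists_strictMono_tendsto_orbitProb (θ : ℝ) (f : UnitAddCircle → ℝ)
    (x : ℕ → UnitAddCircle) (N : ℕ → ℕ) :
    ∃ (μ : ProbabilityMeasure UnitAddCircle) (ψ : ℕ → ℕ), StrictMono ψ ∧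
      Tendsto (fun n => orbitProb θ f (N (ψ n)) (x (ψ n))) atTop (𝓝 μ) :=
  CompactSpace.tendsto_subseq fun n => orbitProb θ f (N n) (x n)

end QuasiPeriodic

theorem mainTheorem5 (θ : ℝ) (hθ : Irrational θ) (f : UnitAddCircle → ℝ)
    (hf : QuasiPeriodic.IsBV f) (hf0 : ∫ x, f x = 0) :
    -- every cluster point is non-atomic and solves the equation
    (∀ (x : ℕ → UnitAddCircle) (N : ℕ → ℕ), StrictMono N →
      ∀ μ : ProbabilityMeasure UnitAddCircle,
        MapClusterPt μ atTop (fun n => QuasiPeriodic.orbitProb θ f (N n) (x n)) →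
          (∀ a : UnitAddCircle, (μ : Measure UnitAddCircle) {a} = 0) ∧
            QuasiPeriodic.IsQuasiInvariant θ f μ) ∧
    -- the equation has exactly one solution, and the weighted averages converge to its integrals
    ∃ ν : ProbabilityMeasure UnitAddCircle,
      QuasiPeriodic.IsQuasiInvariant θ f ν ∧
      (∀ a : UnitAddCircle, (ν : Measure UnitAddCircle) {a} = 0) ∧
      (∀ μ : ProbabilityMeasure UnitAddCircle, QuasiPeriodic.IsQuasiInvariant θ f μ → μ = ν) ∧
      ∀ g : UnitAddCircle → ℝ, QuasiPeriodic.IsBV g →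
        TendstoUniformly (fun n x => QuasiPeriodic.weightedAvg θ f n g x)
          (fun _ => ∫ y, g y ∂(ν : Measure UnitAddCircle)) atTop := by
  obtain ⟨W, V, h⟩ := hf.exists_isVariationBound
  refine ⟨fun x N hN μ hμ => ?_, ?_⟩
  · obtain ⟨ψ, hψ, hlim⟩ := hμ.tendsto_subseq
    have hNψ : Tendsto (fun n => N (ψ n)) atTop atTop := hN.tendsto_atTop.comp hψ.tendsto_atTop
    exact ⟨h.measure_singleton_eq_zero_of_tendsto hf0 hθ (x := fun n => x (ψ n)) hNψ hlim,
      h.isQuasiInvariant_of_tendsto hf0 hθ (x := fun n => x (ψ n)) hNψ hlim⟩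
  -- Any orbit yields a solution; the origin is an arbitrary choice.
  obtain ⟨ν, ψ, hψ, hlim⟩ := QuasiPeriodic.exists_strictMono_tendsto_orbitProb θ f (fun _ => 0) id
  have hν := h.isQuasiInvariant_of_tendsto hf0 hθ (x := fun _ => 0) hψ.tendsto_atTop hlim
  have hν0 := h.measure_singleton_eq_zero_of_tendsto hf0 hθ (x := fun _ => 0) hψ.tendsto_atTop hlim
  refine ⟨ν, hν, hν0, fun μ hμ => h.eq_of_isQuasiInvariant hθ hμ hν, fun g hg => ?_⟩
  obtain ⟨W', V', h'⟩ := hg.exists_isVariationBound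
  rw [Metric.tendstoUniformly_iff]
  intro ε hε
  -- Bad points along increasing times have orbit measures with a subsequential limit, which is ν by
  -- uniqueness. As ν has no atoms, the integrals of g converge to that of ν, a contradiction.
  by_contra hcon
  obtain ⟨N, hN, hNε⟩ := extraction_of_frequently_atTop (not_eventually.mp hcon)
  simp only [not_forall, not_lt] at hNε
  choose x hx using hNε
  obtain ⟨μ, φ, hφ, hμ⟩ := QuasiPeriodic.exists_strictMono_tendsto_orbitProb θ f x N
  have hNφ : Tendsto (fun n => N (φ n)) atTop atTop := hN.tendsto_atTop.comp hφ.tendsto_atTop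
  have hμν : μ = ν := h.eq_of_isQuasiInvariant hθ
    (h.isQuasiInvariant_of_tendsto hf0 hθ (x := fun n => x (φ n)) hNφ hμ) hν
  rw [hμν] at hμ
  have hint := h'.tendsto_integral hμ hν0
  obtain ⟨n, hn⟩ := (Metric.tendsto_nhds.mp hint ε hε).exists
  have he : ∫ y, g y ∂(QuasiPeriodic.orbitProb θ f (N (φ n)) (x (φ n)) : Measure UnitAddCircle)
      = QuasiPeriodic.weightedAvg θ f (N (φ n)) g (x (φ n)) :=
    QuasiPeriodic.integral_orbitMeasure ..
  rw [he, dist_comm] at hn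
  exact absurd hn (not_lt.mpr (hx (φ n)))
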